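/- Let $k$ be a field and let $G$ be a mixed signed, directed graph on a finite vertex set $V$: it has signed edges $+ij$, $-ij$ (loops $\pm ii$ allowed, and $+ij$, $-ij$ may both occur) and directed edges $(i,j)$ with $i\ne j$. Put $\rho(\pm ij)=\pm(e_i+e_j)$ and $\rho((i,j))=e_j-e_i$ in $\mathbb Z^V$. In the Laurent polynomial ring $k[x_v^{\pm1}:v\in V]$ let $k[G]$ be the $k$-subalgebra generated by the monomials $x^{\rho(e)}$, $e\in E(G)$, and let $\mathcal A(\mathcal P_G)$ be the one generated by all monomials $x^a$ with $a\in\mathbb R_{\ge0}\,\rho(E(G))\cap\mathbb Z\rho(E(G))$. The augmented signed graph $\widetilde G$ is obtained from $G$ by replacing each directed edge $p=(i,j)$ by a new vertex $t_p$ and the two signed edges $-i\,t_p$ and $+t_p\,j$; $k[\widetilde G]$ and $\mathcal A(\mathcal P_{\widetilde G})$ are defined in the same way, and $k[x_v^{\pm1}]$ is regarded as a subring of the Laurent polynomial ring on the vertices of $\widetilde G$. A cycle $C$ in a signed graph has distinct vertices $u_1,\dots,u_n$ ($n\ge1$) and distinct signed edges $u_\ell u_{\ell+1}$, indices modulo $n$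 (a loop is a cycle of length $1$); it is odd if $n$ is odd. The signature of $u_\ell$ in $C$ is $\mathrm{sig}_C(u_\ell)=\frac12(\mathrm{sgn}(u_{\ell-1}u_\ell)+\mathrm{sgn}(u_\ell u_{\ell+1}))$. A pair $\Pi=\{C,C'\}$ of vertex-disjoint odd cycles in the same component of a signed graph is exceptional if no path from a vertex of $C$ to a vertex of $C'$ has edges of alternating sign; put $$M_\Pi=\prod_{\ell\in C}x_\ell^{\mathrm{sig}_C(\ell)}\prod_{\ell\in C'}x_\ell^{\mathrm{sig}_{C'}(\ell)}.$$ Then: 1. $\mathcal A(\mathcal P_G)$ is the normalization of $k[G]$, i.e. the integral closure of $k[G]$ in its field of fractions. 2. $\mathcal A(\mathcal P_G)$ is generated as a $k[G]$-algebra by the monomials $M_\Pi$, where $\Pi$ runs over the exceptional pairs of odd cycles in $\widetilde G$. This holds both when paths may not repeat vertices and when a path is any sequence of incident edges, possibly with repetitions. 3. Moreover, whenever $S$ is a set of exceptional pairs of $\widetilde G$ (paths not repeating vertices) such that $\mathcal A(\mathcal P_{\widetilde G})$ is generated by $\{M_\Pi:\Pi\in S\}$ as a $k[\widetilde G]$-algebra,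 $\mathcal A(\mathcal P_G)$ is generated by $\{M_\Pi:\Pi\in S\}$ as a $k[G]$-algebra. -/

import Mathlib

open scoped NNReal

/-! ### Signed graphs and mixed signed, directed graphs -/

/-- A signed graph on the vertex set `V`. The edge `+ij` is the pair `(1, s(i, j))` and `-ij` is
`(-1, s(i, j))`. Loops are allowed, and `+ij` and `-ij` may both be present. -/
structure SignedGraph (V : Type*) where
  /-- the set of signed edges -/
  edges : Set (ℤˣ × Sym2 V)

/-- A mixed signed, directed graph: signed edges (loops allowed) together with directed edges
between distinct vertices, `(i, j)` being directed from `i` to `j`. -/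
structure MixedGraph (V : Type*) extends SignedGraph V where
  /-- the set of directed edges -/
  arcs : Set (V × V)
  arcs_ne : ∀ p ∈ arcs, p.1 ≠ p.2

/-- `ρ(±ij) = ±(e_i + e_j)`; in particular `ρ(±ii) = ±2 e_i`. -/
noncomputable def signedRho {V : Type*} (e : ℤˣ × Sym2 V) : V →₀ ℤ :=
  (e.1 : ℤ) • Sym2.lift ⟨fun i j => Finsupp.single i 1 + Finsupp.single j 1,
    fun _ _ => add_comm _ _⟩ e.2

/-- `ρ((i, j)) = e_j - e_i`. -/
noncomputable def arcRho {V : Type*} (p : V × V) : V →₀ ℤ :=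
  Finsupp.single p.2 1 - Finsupp.single p.1 1

/-- `ρ(E(G))` for a signed graph. -/
def SignedGraph.rhoSet {V : Type*} (G : SignedGraph V) : Set (V →₀ ℤ) :=
  signedRho '' G.edges

/-- `ρ(E(G))` for a mixed signed, directed graph. -/
def MixedGraph.rhoSet {V : Type*} (G : MixedGraph V) : Set (V →₀ ℤ) :=
  signedRho '' G.edges ∪ arcRho '' G.arcs

/-- The augmented signed graph of `G`: the directed edge `p = (i, j)` is replaced by the
artificial vertex `Sum.inr p` and the two edges `-i t_p` and `+t_p j`. -/
def MixedGraph.augmented {V : Type*} (G : MixedGraph V) : SignedGraph (V ⊕ G.arcs) where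
  edges :=
    {e | ∃ f ∈ G.edges, e = (f.1, f.2.map Sum.inl)} ∪
    {e | ∃ p : G.arcs, e = (-1, s(Sum.inl p.1.1, Sum.inr p)) ∨
      e = (1, s(Sum.inr p, Sum.inl p.1.2))}

/-! ### Laurent polynomials, edge rings and normalizations -/

/-- The Laurent polynomial ring `k[x_v^{±1} : v ∈ V]`. -/
abbrev Laurent (k V : Type*) [Field k] : Type _ := AddMonoidAlgebra k (V →₀ ℤ)

/-- The Laurent monomial `x^a`. -/
noncomputable def xpow (k : Type*) {V : Type*} [Field k] (a : V →₀ ℤ) : Laurent k V :=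
  AddMonoidAlgebra.single a 1

/-- The inclusion `ℤ^V → ℝ^V`. -/
noncomputable def toRealVec (V : Type*) : (V →₀ ℤ) →+ (V →₀ ℝ) :=
  Finsupp.mapRange.addMonoidHom (Int.castAddHom ℝ)

/-- The semigroup `T₁ = ℝ₊ R ∩ ℤ R` of a set `R` of integer vectors. -/
noncomputable def coneLattice {V : Type*} (R : Set (V →₀ ℤ)) : AddSubmonoid (V →₀ ℤ) :=
  (AddSubgroup.closure R).toAddSubmonoid ⊓
    (Submodule.span ℝ≥0 (toRealVec V '' R)).toAddSubmonoid.comap (toRealVec V)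

/-- The `k`-algebra generated by the monomials `x^a`, `a ∈ R`. For `R = ρ(E(G))` it is the edge
ring `k[G]`. -/
noncomputable def monomialAlgebra (k : Type*) {V : Type*} [Field k] (R : Set (V →₀ ℤ)) :
    Subalgebra k (Laurent k V) :=
  Algebra.adjoin k (xpow k '' R)

/-- The edge ring `k[G]` of a signed graph. -/
noncomputable def SignedGraph.edgeRing (k : Type*) {V : Type*} [Field k] (G : SignedGraph V) :
    Subalgebra k (Laurent k V) :=
  monomialAlgebra k G.rhoSet

/-- The edge ring `k[G]` of a mixed signed, directed graph. -/
noncomputable def MixedGraph.edgeRing (k : Type*) {V : Type*} [Field k] (G : MixedGraph V) :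
    Subalgebra k (Laurent k V) :=
  monomialAlgebra k G.rhoSet

/-- `A(P_G) = k[T₁]` for a signed graph. -/
noncomputable def SignedGraph.ehrhartRing (k : Type*) {V : Type*} [Field k] (G : SignedGraph V) :
    Subalgebra k (Laurent k V) :=
  monomialAlgebra k (coneLattice G.rhoSet : Set (V →₀ ℤ))

/-- `A(P_G) = k[T₁]` for a mixed signed, directed graph. -/
noncomputable def MixedGraph.ehrhartRing (k : Type*) {V : Type*} [Field k] (G : MixedGraph V) :
    Subalgebra k (Laurent k V) :=
  monomialAlgebra k (coneLattice G.rhoSet : Set (V →₀ ℤ))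

/-- The inclusion of fraction fields `Frac R → Frac L` for a subalgebra `R` of a domain `L`. -/
noncomputable def fracIncl {k L : Type*} [Field k] [CommRing L] [IsDomain L] [Algebra k L]
    (R : Subalgebra k L) : FractionRing R →ₐ[k] FractionRing L :=
  IsFractionRing.liftAlgHom (g := (IsScalarTower.toAlgHom k L (FractionRing L)).comp R.val)
    ((IsFractionRing.injective L (FractionRing L)).comp Subtype.val_injective)

/-- The normalization of a subalgebra `R` of a domain `L`, i.e. the integral closure of `R` in
its own fraction field, viewed inside `Frac L`. -/
noncomputable def normalizationIn {k L : Type*} [Field k] [CommRing L] [IsDomain L] [Algebra k L]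
    (R : Subalgebra k L) : Subalgebra k (FractionRing L) :=
  ((integralClosure R (FractionRing R)).restrictScalars k).map (fracIncl R)

/-- The inclusion `k[x_v^{±1}] → k[x_v^{±1}, t_p^{±1}]`. -/
noncomputable def laurentInl (k V T : Type*) [Field k] : Laurent k V →ₐ[k] Laurent k (V ⊕ T) :=
  AddMonoidAlgebra.mapDomainAlgHom k k (Finsupp.mapDomain.addMonoidHom (Sum.inl : V → V ⊕ T))

/-- The algebra generated over the subring `R` by a set `S`, as a `k`-subalgebra. -/
noncomputable def generatedOver {k L : Type*} [Field k] [CommRing L] [Algebra k L]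
    (R : Subalgebra k L) (S : Set L) : Subalgebra k L :=
  (Algebra.adjoin R S).restrictScalars k

/-! ### Walks, cycles and exceptional pairs in signed graphs -/

namespace SignedGraph

variable {V : Type*}

/-- Walks in a signed graph; each step records the sign of the edge that is used. -/
inductive Walk (G : SignedGraph V) : V → V → Type _
  | nil (u : V) : Walk G u u
  | cons {u v w : V} (s : ℤˣ) (h : (s, s(u, v)) ∈ G.edges) (p : Walk G v w) : Walk G u w

/-- The list of vertices of a walk. -/
def Walk.support {G : SignedGraph V} : {u v : V} → G.Walk u v → List V
  | u, _, .nil _ => [u]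
  | u, _, .cons _ _ p => u :: p.support

/-- The list of signs of the edges of a walk. -/
def Walk.signs {G : SignedGraph V} : {u v : V} → G.Walk u v → List ℤˣ
  | _, _, .nil _ => []
  | _, _, .cons s _ p => s :: p.signs

/-- Consecutive edges have opposite signs. -/
def Walk.IsAlternating {G : SignedGraph V} {u v : V} (p : G.Walk u v) : Prop :=
  p.signs.IsChain (· ≠ ·)

/-- No vertex is repeated. -/
def Walk.IsPath {G : SignedGraph V} {u v : V} (p : G.Walk u v) : Prop :=
  p.support.Nodup

/-- A cycle with distinct vertices `u_0, …, u_{n-1}` and distinct edges `sgn_i · u_i u_{i+1}`,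
indices modulo `n`. For `n = 1` it is a loop, and for `n = 2` it is a pair of parallel edges. -/
structure Cycle (G : SignedGraph V) where
  /-- the length -/
  n : ℕ
  [ne_zero : NeZero n]
  /-- the vertices, in cyclic order -/
  vert : Fin n → V
  /-- `sgn i` is the sign of the edge that joins `vert i` to `vert (i + 1)` -/
  sgn : Fin n → ℤˣ
  edge_mem : ∀ i, (sgn i, s(vert i, vert (i + 1))) ∈ G.edges
  vert_injective : Function.Injective vert
  edge_injective : Function.Injective fun i => (sgn i, s(vert i, vert (i + 1)))

attribute [instance] Cycle.ne_zero

/-- The signature of the `i`-th vertex of a cycle: the average of the signs of the edges of the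
cycle on its two sides (the division is exact, as a sum of two signs is even). -/
def Cycle.sig {G : SignedGraph V} (C : G.Cycle) (i : Fin C.n) : ℤ :=
  ((C.sgn (i - 1) : ℤ) + (C.sgn i : ℤ)) / 2

/-- The monomial `∏_{ℓ ∈ C} x_ℓ ^ sig_C(ℓ)`. -/
noncomputable def Cycle.monomial (k : Type*) [Field k] {G : SignedGraph V} (C : G.Cycle) :
    Laurent k V :=
  ∏ i, xpow k (Finsupp.single (C.vert i) (C.sig i))

/-- The monomial `M_P` of a pair `P = {C, C'}` of cycles. -/
noncomputable def pairMonomial (k : Type*) [Field k] {G : SignedGraph V} (P : G.Cycle × G.Cycle) :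
    Laurent k V :=
  P.1.monomial k * P.2.monomial k

/-- `C` and `C'` are vertex-disjoint odd cycles in the same component of `G`. -/
def IsOddDisjointPair {G : SignedGraph V} (P : G.Cycle × G.Cycle) : Prop :=
  Odd P.1.n ∧ Odd P.2.n ∧ Disjoint (Set.range P.1.vert) (Set.range P.2.vert) ∧
    ∃ i j, Nonempty (G.Walk (P.1.vert i) (P.2.vert j))

/-- The exceptional pairs of odd cycles, with paths not allowed to repeat vertices. -/
def exceptionalPairs (G : SignedGraph V) : Set (G.Cycle × G.Cycle) :=
  {P | IsOddDisjointPair P ∧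
    ¬ ∃ i j, ∃ p : G.Walk (P.1.vert i) (P.2.vert j), p.IsPath ∧ p.IsAlternating}

/-- The exceptional pairs of odd cycles, with a path understood as any sequence of incident edges,
possibly with repetitions. This is a subset of `exceptionalPairs`. -/
def walkExceptionalPairs (G : SignedGraph V) : Set (G.Cycle × G.Cycle) :=
  {P | IsOddDisjointPair P ∧
    ¬ ∃ i j, ∃ p : G.Walk (P.1.vert i) (P.2.vert j), p.IsAlternating}

end SignedGraph

/-! Signed graphs come first. Write a vector of the cone as a nonnegative combination of edge
vectors. Integer parts of the coefficients split off as edge vectors, and a linear relation among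
the edges lets one coefficient be driven to zero. What remains is an independent set of edges with
coefficients in (0, 1). A vertex with a single edge end would make a coefficient an integer, and
there are at most as many edges as vertices, so every vertex has exactly two edge ends. Hence there
is a cycle; independence makes it odd, and integrality forces the coefficients 1/2 on it, so its
contribution is exactly the vector of the cycle (`exists_odd_cycle_half`). Induction writes the
vector as edge vectors plus vectors of odd cycles (`exists_odd_cycles`).

Lattice vectors have even coordinate sum on each component and an odd cycle has odd sum, so the
cycles pair off inside components (`sum_vec_mem_closure`). For an odd cycle C through u, both M_C
x_u and M_C / x_u are monomials in the edges, and an alternating walk telescopes to its two ends; so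
a pair that meets or is joined by an alternating walk contributes nothing new
(`pairVec_mem_closure`). Only exceptional pairs are left.

For mixed graphs, the retraction sending e_{t_p} to -e_i, for p = (i, j), kills the edge -i t_p and
turns +t_p j into e_j - e_i. It maps both algebras of the augmented graph onto those of G. It fixes
each M_Π, because artificial vertices have signature zero, so generating families transfer
(`ehrhartRing_map_eq_of_augmented`).

For the normalization, integral elements of the fraction field are Laurent polynomials, with
exponents in the lattice and in every half-space containing the generators, hence in the cone by
Farkas. Conversely, twice a vector a of the cone semigroup is a sum of edge vectors, so x^a is
integral. -/

/-! ### Edge vectors -/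

section EdgeVectors

variable {V : Type*}

/-- The vector `e_i + e_j` of an unordered pair `ij`. -/
noncomputable def sym2Vec (z : Sym2 V) : V →₀ ℤ :=
  Sym2.lift ⟨fun i j => Finsupp.single i 1 + Finsupp.single j 1, fun _ _ => add_comm _ _⟩ z

lemma sym2Vec_mk (i j : V) :
    sym2Vec s(i, j) = Finsupp.single i 1 + Finsupp.single j 1 := rfl

lemma signedRho_eq (e : ℤˣ × Sym2 V) : signedRho e = (e.1 : ℤ) • sym2Vec e.2 := rfl

lemma signedRho_mk (s : ℤˣ) (i j : V) :
    signedRho (s, s(i, j)) = (s : ℤ) • (Finsupp.single i 1 + Finsupp.single j 1) := rfl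

lemma sign_smul_signedRho (e : ℤˣ × Sym2 V) : (e.1 : ℤ) • signedRho e = sym2Vec e.2 := by
  rw [signedRho_eq, smul_smul, ← Units.val_mul, Int.units_mul_self, Units.val_one, one_smul]

lemma sym2Vec_nonneg (z : Sym2 V) (v : V) : 0 ≤ sym2Vec z v := by
  classical
  induction z using Sym2.ind with
  | _ i j =>
    simp only [sym2Vec_mk, Finsupp.add_apply, Finsupp.single_apply]
    split_ifs <;> norm_num

lemma sym2Vec_pos_iff (z : Sym2 V) (v : V) : 0 < sym2Vec z v ↔ v ∈ z := by
  classical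
  induction z using Sym2.ind with
  | _ i j =>
    simp only [sym2Vec_mk, Finsupp.add_apply, Finsupp.single_apply, Sym2.mem_iff]
    split_ifs <;> grind

lemma sym2Vec_le_one {z : Sym2 V} (hz : ¬ z.IsDiag) (v : V) : sym2Vec z v ≤ 1 := by
  classical
  induction z using Sym2.ind with
  | _ i j =>
    rw [Sym2.mk_isDiag_iff] at hz
    simp only [sym2Vec_mk, Finsupp.add_apply, Finsupp.single_apply]
    split_ifs <;> grind

lemma sum_sym2Vec {z : Sym2 V} {U : Finset V} (hU : ∀ v ∈ z, v ∈ U) :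
    ∑ v ∈ U, sym2Vec z v = 2 := by
  classical
  induction z using Sym2.ind with
  | _ i j =>
    have hi := hU i (Sym2.mem_mk_left i j)
    have hj := hU j (Sym2.mem_mk_right i j)
    simp [sym2Vec_mk, Finset.sum_add_distrib, Finsupp.single_apply, hi, hj]

end EdgeVectors

/-- An alternating sum of the sums of consecutive terms telescopes. -/
lemma sum_range_alternating {A : Type*} [AddCommGroup A] (E : ℕ → A) (n : ℕ) :
    ∑ k ∈ Finset.range n, (-1 : ℤ) ^ k • (E k + E (k + 1)) = E 0 - (-1 : ℤ) ^ n • E n := by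
  induction n with
  | zero => simp
  | succ n ih =>
    rw [Finset.sum_range_succ, ih, pow_succ]
    module

lemma closure_le_coneLattice {V : Type*} (R : Set (V →₀ ℤ)) :
    AddSubmonoid.closure R ≤ coneLattice R :=
  AddSubmonoid.closure_le.mpr fun _ ha =>
    ⟨AddSubgroup.subset_closure ha, Submodule.subset_span ⟨_, ha, rfl⟩⟩

namespace SignedGraph

variable {V : Type*} {G : SignedGraph V}

/-! ### The vectors of cycles -/

/-- The exponent vector `∑_{ℓ ∈ C} sig_C(ℓ) e_ℓ`. -/
noncomputable def Cycle.vec (C : G.Cycle) : V →₀ ℤ :=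
  ∑ i, Finsupp.single (C.vert i) (C.sig i)

/-- The exponent vector of the monomial `M_P`. -/
noncomputable def pairVec (P : G.Cycle × G.Cycle) : V →₀ ℤ :=
  P.1.vec + P.2.vec

/-- The `i`-th edge of a cycle. -/
def Cycle.edge (C : G.Cycle) (i : Fin C.n) : ℤˣ × Sym2 V :=
  (C.sgn i, s(C.vert i, C.vert (i + 1)))

lemma Cycle.edge_mem' (C : G.Cycle) (i : Fin C.n) : C.edge i ∈ G.edges := C.edge_mem i

lemma Cycle.two_mul_sig (C : G.Cycle) (i : Fin C.n) :
    2 * C.sig i = (C.sgn (i - 1) : ℤ) + (C.sgn i : ℤ) := by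
  unfold Cycle.sig
  rcases Int.units_eq_one_or (C.sgn (i - 1)) with h | h <;>
    rcases Int.units_eq_one_or (C.sgn i) with h' | h' <;> simp [h, h']

lemma Cycle.sum_sub_one {A : Type*} [AddCommMonoid A] (C : G.Cycle) (f : Fin C.n → Fin C.n → A) :
    ∑ i, f (i - 1) i = ∑ i, f i (i + 1) := by
  rw [← Equiv.sum_comp (Equiv.addRight (1 : Fin C.n))]
  simp

lemma Cycle.two_smul_vec (C : G.Cycle) :
    (2 : ℤ) • C.vec = ∑ i, signedRho (C.edge i) := by
  unfold Cycle.vec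
  rw [Finset.smul_sum]
  have h1 : ∀ i, (2 : ℤ) • Finsupp.single (C.vert i) (C.sig i) =
      Finsupp.single (C.vert i) (C.sgn (i - 1) : ℤ) + Finsupp.single (C.vert i) (C.sgn i : ℤ) := by
    intro i
    rw [Finsupp.smul_single, smul_eq_mul, C.two_mul_sig, Finsupp.single_add]
  rw [Finset.sum_congr rfl fun i _ => h1 i, Finset.sum_add_distrib,
    C.sum_sub_one fun a b => Finsupp.single (C.vert b) (C.sgn a : ℤ), ← Finset.sum_add_distrib]
  refine Finset.sum_congr rfl fun i _ => ?_
  simp [Cycle.edge, signedRho_mk, add_comm]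

lemma Cycle.sum_alternating (C : G.Cycle) (u : Fin C.n) :
    ∑ j : Fin C.n, (-1 : ℤ) ^ (j : ℕ) • sym2Vec (C.edge (u + j)).2 =
      Finsupp.single (C.vert u) 1 - (-1 : ℤ) ^ C.n • Finsupp.single (C.vert u) 1 := by
  -- Positions are naturals read modulo the length, so the telescoping sum begins and ends at the
  -- same vertex.
  have h := sum_range_alternating
    (fun k => Finsupp.single (C.vert (u + Fin.ofNat C.n k)) (1 : ℤ)) C.n
  have h0 : Fin.ofNat C.n 0 = 0 := rfl
  have hn : Fin.ofNat C.n C.n = 0 := by ext; simp [Fin.ofNat]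
  rw [h0, hn, add_zero] at h
  rw [← h, ← Fin.sum_univ_eq_sum_range
    (fun k => (-1 : ℤ) ^ k • (Finsupp.single (C.vert (u + Fin.ofNat C.n k)) (1 : ℤ) +
      Finsupp.single (C.vert (u + Fin.ofNat C.n (k + 1))) (1 : ℤ)))]
  refine Finset.sum_congr rfl fun j _ => ?_
  have h1 : Fin.ofNat C.n j = j := by ext; simp [Fin.ofNat, Nat.mod_eq_of_lt j.isLt]
  have h2 : Fin.ofNat C.n (j + 1) = j + 1 := by
    ext; simp [Fin.ofNat, Fin.val_add]
  rw [h1, h2, Cycle.edge, sym2Vec_mk, add_assoc]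

lemma Cycle.sum_shift {A : Type*} [AddCommMonoid A] (C : G.Cycle) (u : Fin C.n)
    (f : Fin C.n → A) : ∑ i, f (u + i) = ∑ i, f i :=
  Equiv.sum_comp (Equiv.addLeft u) f

lemma signedRho_mem_closure {e : ℤˣ × Sym2 V} (he : e ∈ G.edges) :
    signedRho e ∈ AddSubmonoid.closure G.rhoSet :=
  AddSubmonoid.subset_closure ⟨e, he, rfl⟩

/-- For an odd cycle `C` through `u`, both `M_C x_u` and `M_C x_u⁻¹` are monomials of the edge
ring. -/
lemma Cycle.vec_add_single_mem (C : G.Cycle) (hC : Odd C.n) (u : Fin C.n) (s : ℤˣ) :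
    C.vec + Finsupp.single (C.vert u) (s : ℤ) ∈ AddSubmonoid.closure G.rhoSet := by
  -- Twice the cycle vector has coefficient 1 on every edge, and 2s e_u is the alternating sum with
  -- coefficients c j = ±1. Their sum has coefficients 0 or 2, and m is half of it.
  let c : Fin C.n → ℤˣ := fun j => s * (-1) ^ (j : ℕ) * C.sgn (u + j)
  let m : V →₀ ℤ := ∑ j, if c j = 1 then signedRho (C.edge (u + j)) else 0
  have hm : m ∈ AddSubmonoid.closure G.rhoSet := by
    refine sum_mem fun j _ => ?_
    split_ifs
    exacts [signedRho_mem_closure (C.edge_mem' _), zero_mem _]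
  have key : (2 : ℤ) • (C.vec + Finsupp.single (C.vert u) (s : ℤ)) = (2 : ℤ) • m := by
    have h1 := C.sum_alternating u
    rw [hC.neg_one_pow] at h1
    have h2 : (2 : ℤ) • Finsupp.single (C.vert u) (s : ℤ) =
        ∑ j : Fin C.n, (c j : ℤ) • signedRho (C.edge (u + j)) := by
      have : (2 : ℤ) • Finsupp.single (C.vert u) (s : ℤ) = (s : ℤ) •
          (Finsupp.single (C.vert u) 1 - (-1 : ℤ) • Finsupp.single (C.vert u) 1) := by
        rw [neg_one_smul, sub_neg_eq_add, ← two_smul ℤ, smul_smul, mul_comm, ← smul_smul]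
        simp
      rw [this, ← h1, Finset.smul_sum]
      refine Finset.sum_congr rfl fun j _ => ?_
      rw [← sign_smul_signedRho, smul_smul, smul_smul]
      simp [c, Cycle.edge]
    rw [smul_add, h2, C.two_smul_vec, ← C.sum_shift u, ← Finset.sum_add_distrib, Finset.smul_sum]
    refine Finset.sum_congr rfl fun j _ => ?_
    rcases Int.units_eq_one_or (c j) with h | h <;> simp [h, two_smul]
  have : C.vec + Finsupp.single (C.vert u) (s : ℤ) = m := by
    ext v
    have := DFunLike.congr_fun key v
    simp only [Finsupp.smul_apply, smul_eq_mul] at this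
    omega
  rwa [this]

/-! ### Walks -/

/-- The sum of the edges of an alternating walk only involves the two ends. -/
lemma Walk.IsAlternating.exists_mem_closure {u v w : V} {s : ℤˣ} {h : (s, s(u, v)) ∈ G.edges}
    {p : G.Walk v w} (hp : (Walk.cons s h p).IsAlternating) :
    ∃ t : ℤˣ, Finsupp.single u (s : ℤ) + Finsupp.single w (t : ℤ) ∈
      AddSubmonoid.closure G.rhoSet := by
  induction p generalizing u s with
  | nil v =>
    refine ⟨s, ?_⟩
    have := signedRho_mem_closure h
    simpa [signedRho_mk] using this
  | @cons v x w s' h' q ih =>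
    have hp' : s ≠ s' ∧ (Walk.cons s' h' q).IsAlternating := by
      simpa [Walk.IsAlternating, Walk.signs] using hp
    obtain ⟨t, ht⟩ := ih hp'.2
    refine ⟨t, ?_⟩
    have := add_mem (signedRho_mem_closure h) ht
    -- The next edge has the opposite sign, so the two contributions at the middle vertex cancel.
    rw [Int.units_ne_iff_eq_neg.mp hp'.1.symm] at this
    convert this using 1
    simp [signedRho_mk]

/-- Adding an edge at the end of a walk. -/
lemma Walk.nonempty_concat {u v w : V} (p : G.Walk u v) {s : ℤˣ} (h : (s, s(v, w)) ∈ G.edges) :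
    Nonempty (G.Walk u w) := by
  induction p with
  | nil => exact ⟨.cons s h (.nil w)⟩
  | cons s' h' q ih =>
    obtain ⟨q'⟩ := ih h
    exact ⟨.cons s' h' q'⟩

/-- In the group the signs of the edges no longer matter, so an alternating sum can be formed along
any walk. -/
lemma Walk.exists_mem_lattice {u w : V} (p : G.Walk u w) :
    ∃ t : ℤˣ, Finsupp.single u 1 + Finsupp.single w (t : ℤ) ∈ AddSubgroup.closure G.rhoSet := by
  induction p with
  | nil u => exact ⟨-1, by simp⟩
  | @cons u v w s h q ih =>
    obtain ⟨t, ht⟩ := ih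
    refine ⟨-t, ?_⟩
    have h1 : sym2Vec s(u, v) ∈ AddSubgroup.closure G.rhoSet := by
      rw [← sign_smul_signedRho (s, s(u, v))]
      exact zsmul_mem (AddSubgroup.subset_closure (Set.mem_image_of_mem _ h)) _
    convert sub_mem h1 ht using 1
    simp only [sym2Vec_mk, Units.val_neg, Finsupp.single_neg]
    abel

lemma closure_rhoSet_le_lattice :
    AddSubmonoid.closure G.rhoSet ≤ (AddSubgroup.closure G.rhoSet).toAddSubmonoid :=
  AddSubmonoid.closure_le.mpr AddSubgroup.subset_closure

lemma Cycle.vec_mem_cone (C : G.Cycle) :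
    toRealVec V C.vec ∈ Submodule.span ℝ≥0 (toRealVec V '' G.rhoSet) := by
  have h : toRealVec V C.vec = (1 / 2 : ℝ≥0) • ∑ i, toRealVec V (signedRho (C.edge i)) := by
    rw [← map_sum, ← C.two_smul_vec, map_zsmul]
    ext v
    simp [NNReal.smul_def]
  rw [h]
  exact Submodule.smul_mem _ _ (Submodule.sum_mem _ fun i _ =>
    Submodule.subset_span ⟨_, ⟨_, C.edge_mem' i, rfl⟩, rfl⟩)

/-- Each cycle vector is half a sum of edges, which gives the cone. For the lattice, each cycle
vector is corrected at one vertex, and the two corrections are undone by the alternating sum along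
the walk. -/
lemma pairVec_mem_coneLattice {P : G.Cycle × G.Cycle} (h1 : Odd P.1.n) (h2 : Odd P.2.n)
    {i : Fin P.1.n} {j : Fin P.2.n} (p : G.Walk (P.1.vert i) (P.2.vert j)) :
    pairVec P ∈ coneLattice G.rhoSet := by
  refine ⟨?_, ?_⟩
  · obtain ⟨t, ht⟩ := p.exists_mem_lattice
    have h3 : _ ∈ AddSubgroup.closure G.rhoSet :=
      closure_rhoSet_le_lattice (P.1.vec_add_single_mem h1 i (-1))
    have h4 : _ ∈ AddSubgroup.closure G.rhoSet :=
      closure_rhoSet_le_lattice (P.2.vec_add_single_mem h2 j (-t))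
    change pairVec P ∈ AddSubgroup.closure G.rhoSet
    convert add_mem (add_mem h3 h4) ht using 1
    simp only [pairVec, Units.val_neg, Units.val_one, Finsupp.single_neg]
    abel
  · change toRealVec V (pairVec P) ∈ Submodule.span ℝ≥0 (toRealVec V '' G.rhoSet)
    rw [pairVec, map_add]
    exact add_mem P.1.vec_mem_cone P.2.vec_mem_cone

/-- The sum of the vectors of two odd cycles that meet, or that are joined by an alternating walk,
is a sum of edge vectors. -/
lemma pairVec_mem_closure (P : G.Cycle × G.Cycle) (h1 : Odd P.1.n) (h2 : Odd P.2.n)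
    {i : Fin P.1.n} {j : Fin P.2.n} (p : G.Walk (P.1.vert i) (P.2.vert j))
    (hp : p.IsAlternating) : pairVec P ∈ AddSubmonoid.closure G.rhoSet := by
  -- The signs at the two ends are immaterial, since an odd cycle can absorb either one.
  suffices ∃ s t : ℤˣ, Finsupp.single (P.1.vert i) (s : ℤ) + Finsupp.single (P.2.vert j) (t : ℤ) ∈
      AddSubmonoid.closure G.rhoSet by
    obtain ⟨s, t, h⟩ := this
    convert add_mem (add_mem (P.1.vec_add_single_mem h1 i (-s))
      (P.2.vec_add_single_mem h2 j (-t))) h using 1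
    simp [pairVec]
    abel
  generalize P.1.vert i = u at p
  generalize P.2.vert j = w at p
  cases p with
  | nil => exact ⟨1, -1, by simp⟩
  | cons s h q => exact ⟨s, hp.exists_mem_closure⟩

end SignedGraph

/-! ### Cycles in simple graphs -/

/-- A finite simple graph with an edge, in which every vertex of positive degree has at least two
neighbours, contains a cycle. -/
lemma SimpleGraph.not_isAcyclic_of_two_neighbors {V : Type*} [Finite V] (Γ : SimpleGraph V)
    {a b : V} (hab : Γ.Adj a b)
    (h : ∀ u v, Γ.Adj u v → ∃ w, w ≠ v ∧ Γ.Adj u w) : ¬ Γ.IsAcyclic := by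
  intro hΓ
  have : Nonempty V := ⟨a⟩
  -- A second neighbour of the first vertex of a longest path either prolongs the path or closes a
  -- cycle with it.
  obtain ⟨u, v, p, hp, hmax⟩ := Walk.exists_isPath_forall_isPath_length_le_length Γ
  have hlen : 1 ≤ p.length := by simpa using hmax _ _ _ (Walk.IsPath.of_adj hab)
  have hnil : ¬ p.Nil := by
    rw [Walk.not_nil_iff_lt_length]
    omega
  obtain ⟨w, hw, huw⟩ := h u _ (p.adj_snd hnil)
  by_cases hs : w ∈ p.support
  · exact hw (hΓ.eq_snd_of_adj_start hp huw hs)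
  · have := hmax _ _ (Walk.cons huw.symm p) (hp.cons hs)
    rw [Walk.length_cons] at this
    omega

/-! ### Independent edges with fractional coefficients -/

namespace SignedGraph

variable {V : Type*} {G : SignedGraph V}

/-- The edge vector `ρ(e)` in `ℝ^V`. -/
noncomputable def realRho (e : ℤˣ × Sym2 V) : V →₀ ℝ := toRealVec V (signedRho e)

lemma toRealVec_apply (a : V →₀ ℤ) (v : V) : toRealVec V a v = (a v : ℝ) := rfl

lemma toRealVec_injective : Function.Injective (toRealVec V) := fun a b h => by
  ext v
  have := DFunLike.congr_fun h v
  simpa [toRealVec_apply] using this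

lemma realRho_apply (e : ℤˣ × Sym2 V) (v : V) :
    realRho e v = ((e.1 : ℤ) : ℝ) * (sym2Vec e.2 v : ℝ) := by
  rw [realRho, toRealVec_apply, signedRho_eq]
  simp

/-- The vertices of a set of edges. -/
noncomputable def edgeVerts [DecidableEq V] (F : Finset (ℤˣ × Sym2 V)) : Finset V :=
  F.biUnion fun e => e.2.toFinset

lemma mem_edgeVerts [DecidableEq V] {F : Finset (ℤˣ × Sym2 V)} {v : V} :
    v ∈ edgeVerts F ↔ ∃ e ∈ F, v ∈ e.2 := by
  simp [edgeVerts]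

/-- Linearly independent edges are not more numerous than their vertices. -/
lemma card_le_card_edgeVerts [DecidableEq V] {F : Finset (ℤˣ × Sym2 V)}
    (hF : LinearIndepOn ℝ realRho (F : Set (ℤˣ × Sym2 V))) : F.card ≤ (edgeVerts F).card := by
  classical
  have h := linearIndependent_le_span_aux' (fun e : (F : Set (ℤˣ × Sym2 V)) => realRho e.1) hF
    (w := ((edgeVerts F).image fun v => Finsupp.single v (1 : ℝ) : Finset _)) (by
      rintro _ ⟨⟨e, he⟩, rfl⟩
      obtain ⟨s, z⟩ := e
      have hmem : ∀ v ∈ z, Finsupp.single v (1 : ℝ) ∈ Submodule.span ℝ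
          (((edgeVerts F).image fun v => Finsupp.single v (1 : ℝ) : Finset _) : Set (V →₀ ℝ)) :=
        fun v hv => Submodule.subset_span (by
          simp only [Finset.coe_image]
          exact Set.mem_image_of_mem _ (mem_edgeVerts.mpr ⟨_, he, hv⟩))
      induction z using Sym2.ind with
      | _ i j =>
        have : realRho (s, s(i, j)) =
            ((s : ℤ) : ℝ) • (Finsupp.single i (1 : ℝ) + Finsupp.single j 1) := by
          ext v
          simp [realRho_apply, sym2Vec_mk, Finsupp.single_apply, mul_add]
        simp only [this]
        exact Submodule.smul_mem _ _ (add_mem (hmem i (Sym2.mem_mk_left i j))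
          (hmem j (Sym2.mem_mk_right i j))))
  simp only [Finset.coe_sort_coe, Fintype.card_coe] at h
  exact h.trans Finset.card_image_le

/-- A set of linearly independent edges carrying coefficients in `(0, 1)` whose combination is an
integer vector has exactly two edge ends at each of its vertices. -/
lemma degree_eq_two [DecidableEq V] {F : Finset (ℤˣ × Sym2 V)}
    (hF : LinearIndepOn ℝ realRho (F : Set (ℤˣ × Sym2 V))) {c : ℤˣ × Sym2 V → ℝ}
    (h0 : ∀ e ∈ F, 0 < c e) (h1 : ∀ e ∈ F, c e < 1) {a : V →₀ ℤ}
    (ha : toRealVec V a = ∑ e ∈ F, c e • realRho e) {v : V} (hv : v ∈ edgeVerts F) :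
    ∑ e ∈ F, sym2Vec e.2 v = 2 := by
  -- With a single edge end at v, the integer `a v` would equal `± c e`, which lies strictly between
  -- consecutive integers.
  have hge : ∀ v ∈ edgeVerts F, 2 ≤ ∑ e ∈ F, sym2Vec e.2 v := by
    intro v hv
    obtain ⟨e, he, hve⟩ := mem_edgeVerts.mp hv
    by_contra! hlt
    have hpos := (sym2Vec_pos_iff e.2 v).mpr hve
    have hsplit := Finset.add_sum_erase F (fun e => sym2Vec e.2 v) he
    have hrest : 0 ≤ ∑ e ∈ F.erase e, sym2Vec e.2 v :=
      Finset.sum_nonneg fun e _ => sym2Vec_nonneg e.2 v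
    beta_reduce at hsplit
    have hone : sym2Vec e.2 v = 1 := by omega
    have hzero : ∑ e ∈ F.erase e, sym2Vec e.2 v = 0 := by omega
    rw [Finset.sum_eq_zero_iff_of_nonneg fun e _ => sym2Vec_nonneg e.2 v] at hzero
    have hav : (a v : ℝ) = ((e.1 : ℤ) : ℝ) * c e := by
      rw [← toRealVec_apply, ha, Finsupp.finsetSum_apply, ← Finset.add_sum_erase F _ he,
        Finset.sum_eq_zero]
      · simp [realRho_apply, hone, mul_comm]
      · intro f hf
        simp [realRho_apply, hzero f hf]
    have hc0 := h0 e he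
    have hc1 := h1 e he
    rcases Int.units_eq_one_or e.1 with hs | hs
    · simp only [hs, Units.val_one, Int.cast_one, one_mul] at hav
      rw [← hav] at hc0 hc1
      norm_cast at hc0 hc1
      omega
    · simp only [hs, Units.val_neg, Units.val_one, Int.cast_neg, Int.cast_one, neg_mul,
        one_mul] at hav
      rw [show c e = ((-a v : ℤ) : ℝ) by push_cast; linarith] at hc0 hc1
      norm_cast at hc0 hc1
      omega
  -- Double counting of edge ends: two per edge, at least two per vertex, and no more edges than
  -- vertices, so equality holds everywhere.
  have htot : ∑ v ∈ edgeVerts F, ∑ e ∈ F, sym2Vec e.2 v = 2 * F.card := by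
    rw [Finset.sum_comm, Finset.sum_congr rfl fun e he =>
      sum_sym2Vec fun v hv => mem_edgeVerts.mpr ⟨e, he, hv⟩]
    simp [mul_comm]
  have hle : ∑ v ∈ edgeVerts F, ∑ e ∈ F, sym2Vec e.2 v ≤ ∑ v ∈ edgeVerts F, 2 := by
    rw [htot]
    have := card_le_card_edgeVerts hF
    simp only [Finset.sum_const, nsmul_eq_mul]
    have : (F.card : ℤ) ≤ (edgeVerts F).card := by exact_mod_cast this
    linarith
  have heq := le_antisymm (Finset.sum_le_sum hge) hle
  exact ((Finset.sum_eq_sum_iff_of_le hge).mp heq v hv).symm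

/-- A cycle of length at least three in the underlying simple graph gives a cycle. -/
lemma exists_cycle_of_simple {F : Finset (ℤˣ × Sym2 V)} (hFG : (F : Set _) ⊆ G.edges)
    {Γ : SimpleGraph V} (hΓ : ∀ i j, Γ.Adj i j → ∃ s, (s, s(i, j)) ∈ F) {u : V}
    {w : Γ.Walk u u} (hw : w.IsCycle) : ∃ C : G.Cycle, ∀ i, C.edge i ∈ F := by
  have hlen := hw.three_le_length
  have : NeZero w.length := ⟨by omega⟩
  have hsucc : ∀ i : Fin w.length, w.getVert (i + 1 : Fin w.length) = w.getVert (i + 1 : ℕ) := by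
    intro i
    rw [Fin.val_add]
    have h1 : ((1 : Fin w.length) : ℕ) = 1 := by
      rw [Fin.val_one', Nat.mod_eq_of_lt (by omega)]
    rw [h1]
    rcases Nat.lt_or_ge (i + 1 : ℕ) w.length with h | h
    · rw [Nat.mod_eq_of_lt h]
    · have : (i + 1 : ℕ) = w.length := by omega
      rw [this, Nat.mod_self, w.getVert_zero, w.getVert_length]
  have hadj : ∀ i : Fin w.length, ∃ s,
      (s, s(w.getVert i, w.getVert (i + 1 : Fin w.length))) ∈ F := by
    intro i
    rw [hsucc]
    exact hΓ _ _ (w.adj_getVert_succ i.isLt)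
  choose s hs using hadj
  have hinj : Function.Injective fun i : Fin w.length => w.getVert i := by
    intro i j hij
    have := hw.getVert_injOn' (x₁ := i) (x₂ := j) (by simp only [Set.mem_ofPred_eq]; omega)
      (by simp only [Set.mem_ofPred_eq]; omega) hij
    exact Fin.ext this
  -- This is where length at least three enters: equal edges traversed in opposite directions would
  -- give i = i + 2.
  have htwo : (1 + 1 : Fin w.length) ≠ 0 := by
    intro h
    have := congrArg Fin.val h
    rw [Fin.val_add, Fin.val_one', Nat.mod_eq_of_lt (by omega : 1 < w.length),
      Nat.mod_eq_of_lt (by omega)] at this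
    simp at this
  refine ⟨{
    n := w.length
    vert := fun i => w.getVert i
    sgn := s
    edge_mem := fun i => hFG (hs i)
    vert_injective := hinj
    edge_injective := ?_ }, hs⟩
  intro i j hij
  have h2 := (Prod.ext_iff.mp hij).2
  rcases Sym2.eq_iff.mp h2 with ⟨h, -⟩ | ⟨h, h'⟩
  · exact hinj h
  · have e1 : i = j + 1 := hinj h
    have e2 : i + 1 = j := hinj h'
    rw [← e2, add_assoc] at e1
    exact absurd (left_eq_add.mp e1) htwo

/-- A nonempty set of edges with exactly two edge ends at each of its vertices, and without
parallel edges, contains a cycle. -/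
lemma exists_cycle [Finite V] [DecidableEq V] {F : Finset (ℤˣ × Sym2 V)}
    (hFG : (F : Set _) ⊆ G.edges) (hne : F.Nonempty)
    (hdeg : ∀ v ∈ edgeVerts F, ∑ e ∈ F, sym2Vec e.2 v = 2)
    (hpar : ∀ e ∈ F, ∀ f ∈ F, e.2 = f.2 → e = f) :
    ∃ C : G.Cycle, ∀ i, C.edge i ∈ F := by
  by_cases hloop : ∃ s v, (s, s(v, v)) ∈ F
  · obtain ⟨s, v, hF⟩ := hloop
    exact ⟨{
      n := 1
      vert := fun _ => v
      sgn := fun _ => s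
      edge_mem := fun _ => hFG hF
      vert_injective := fun _ _ _ => Subsingleton.elim _ _
      edge_injective := fun _ _ _ => Subsingleton.elim _ _ }, fun _ => hF⟩
  push Not at hloop
  let Γ : SimpleGraph V := SimpleGraph.fromEdgeSet (Prod.snd '' (F : Set (ℤˣ × Sym2 V)))
  have hΓ : ∀ i j, Γ.Adj i j ↔ ∃ s, (s, s(i, j)) ∈ F := by
    intro i j
    simp only [Γ, SimpleGraph.fromEdgeSet_adj]
    constructor
    · rintro ⟨⟨⟨s, z⟩, he, rfl⟩, -⟩
      exact ⟨s, he⟩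
    · rintro ⟨s, hs⟩
      refine ⟨⟨_, hs, rfl⟩, ?_⟩
      rintro rfl
      exact hloop _ _ hs
  obtain ⟨⟨s, z⟩, he⟩ := hne
  induction z using Sym2.ind with
  | _ a b =>
  have hcyc : ¬ Γ.IsAcyclic := by
    refine Γ.not_isAcyclic_of_two_neighbors ((hΓ a b).mpr ⟨s, he⟩) fun u v huv => ?_
    obtain ⟨s, hs⟩ := (hΓ u v).mp huv
    have hd := hdeg u (mem_edgeVerts.mpr ⟨_, hs, Sym2.mem_mk_left u v⟩)
    rw [← Finset.add_sum_erase F _ hs] at hd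
    -- A non-loop has only one end at u, so the second end belongs to another edge; without parallel
    -- edges it leads to a new neighbour.
    have hle := sym2Vec_le_one (z := s(u, v)) (by rw [Sym2.mk_isDiag_iff]; exact huv.ne) u
    have : ∑ e ∈ F.erase (s, s(u, v)), sym2Vec e.2 u ≠ 0 := by
      intro h0
      simp only [h0] at hd
      omega
    obtain ⟨⟨t, z⟩, hf, hfu⟩ := Finset.exists_ne_zero_of_sum_ne_zero this
    have hmem := (sym2Vec_pos_iff z u).mp (lt_of_le_of_ne (sym2Vec_nonneg z u) (Ne.symm hfu))
    obtain ⟨x, rfl⟩ := Sym2.mem_iff_exists.mp hmem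
    rw [Finset.mem_erase] at hf
    refine ⟨x, ?_, (hΓ u x).mpr ⟨t, hf.2⟩⟩
    rintro rfl
    exact hf.1 (hpar _ hf.2 _ hs rfl)
  simp only [SimpleGraph.IsAcyclic, not_forall, not_not] at hcyc
  obtain ⟨u, w, hw⟩ := hcyc
  exact exists_cycle_of_simple hFG (fun i j h => (hΓ i j).mp h) hw

lemma Cycle.edge_injective' (C : G.Cycle) : Function.Injective C.edge := C.edge_injective

lemma Cycle.sum_sym2Vec_edge (C : G.Cycle) (i : Fin C.n) :
    ∑ j, sym2Vec (C.edge j).2 (C.vert i) = 2 := by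
  classical
  simp only [Cycle.edge, sym2Vec_mk, Finsupp.add_apply, Finset.sum_add_distrib,
    Finsupp.single_apply, C.vert_injective.eq_iff]
  rw [← C.sum_sub_one fun _ j => if j = i then (1 : ℤ) else 0]
  simp

/-- A nonempty set of linearly independent edges carrying coefficients in `(0, 1)` whose
combination is an integer vector contains an odd cycle, with coefficients `1 / 2`. -/
lemma exists_odd_cycle_half [Finite V] {F : Finset (ℤˣ × Sym2 V)}
    (hFG : (F : Set _) ⊆ G.edges) (hne : F.Nonempty)
    (hF : LinearIndepOn ℝ realRho (F : Set (ℤˣ × Sym2 V))) {c : ℤˣ × Sym2 V → ℝ}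
    (h0 : ∀ e ∈ F, 0 < c e) (h1 : ∀ e ∈ F, c e < 1) {a : V →₀ ℤ}
    (ha : toRealVec V a = ∑ e ∈ F, c e • realRho e) :
    ∃ C : G.Cycle, Odd C.n ∧ ∀ i, C.edge i ∈ F ∧ c (C.edge i) = 1 / 2 := by
  classical
  have hdeg := fun v hv => degree_eq_two hF h0 h1 ha (v := v) hv
  -- Distinct parallel edges have opposite signs, hence opposite vectors, against independence.
  have hpar : ∀ e ∈ F, ∀ f ∈ F, e.2 = f.2 → e = f := by
    rintro ⟨s, z⟩ he ⟨t, z'⟩ hf h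
    obtain rfl : z = z' := h
    by_contra hst
    have hst' : s = -t := Int.units_ne_iff_eq_neg.mp fun h => hst (by rw [h])
    have hsub : ({(s, z), (t, z)} : Set (ℤˣ × Sym2 V)) ⊆ F := by
      rintro _ (rfl | rfl)
      exacts [he, hf]
    have := (LinearIndepOn.pair_iff realRho hst).mp (hF.mono hsub) 1 1 (by
      ext v
      simp [realRho_apply, hst'])
    exact one_ne_zero this.1
  obtain ⟨C, hC⟩ := exists_cycle hFG hne hdeg hpar
  -- Around an even cycle the alternating sum of the vectors e_i + e_j vanishes, a linear relation
  -- among the edges.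
  have hodd : Odd C.n := by
    by_contra hev
    rw [Nat.not_odd_iff_even] at hev
    have hs := C.sum_alternating 0
    rw [hev.neg_one_pow, one_smul, sub_self] at hs
    have hli : LinearIndependent ℝ fun j : Fin C.n => realRho (C.edge j) :=
      hF.comp (fun j => ⟨C.edge j, hC j⟩) fun i j h => C.edge_injective' (congrArg Subtype.val h)
    rw [Fintype.linearIndependent_iff] at hli
    have := hli (fun j => ((-1 : ℤ) ^ (j : ℕ) * (C.sgn j : ℤ) : ℤ)) (by
      ext v
      have h2 := DFunLike.congr_fun hs v
      simp only [Finsupp.finsetSum_apply, Finsupp.smul_apply, smul_eq_mul, zero_add,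
        Finsupp.coe_zero, Pi.zero_apply] at h2 ⊢
      rw [← Int.cast_zero, ← h2, Int.cast_sum]
      refine Finset.sum_congr rfl fun j _ => ?_
      have hsq : ((C.sgn j : ℤ) : ℝ) * ((C.sgn j : ℤ) : ℝ) = 1 := by
        rw [← Int.cast_mul, ← Units.val_mul, Int.units_mul_self]
        simp
      rw [realRho_apply, Cycle.edge]
      push_cast
      linear_combination ((-1 : ℝ) ^ (j : ℕ) * (sym2Vec s(C.vert j, C.vert (j + 1)) v : ℝ)) * hsq)
      0
    simp at this
  refine ⟨C, hodd, ?_⟩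
  -- The cycle already accounts for both edge ends at each of its vertices.
  have hother : ∀ i, ∀ e ∈ F \ Finset.univ.image C.edge, sym2Vec e.2 (C.vert i) = 0 := by
    intro i
    have hsub : Finset.univ.image C.edge ⊆ F := by
      intro e he
      obtain ⟨j, -, rfl⟩ := Finset.mem_image.mp he
      exact hC j
    have hd := hdeg (C.vert i) (mem_edgeVerts.mpr ⟨_, hC i, Sym2.mem_mk_left _ _⟩)
    rw [← Finset.sum_sdiff hsub, Finset.sum_image C.edge_injective'.injOn,
      C.sum_sym2Vec_edge i, add_eq_right,
      Finset.sum_eq_zero_iff_of_nonneg fun e _ => sym2Vec_nonneg e.2 _] at hd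
    exact hd
  let μ : Fin C.n → ℝ := fun i => c (C.edge i) * ((C.sgn i : ℤ) : ℝ)
  have hμ : ∀ i, (a (C.vert i) : ℝ) = μ (i - 1) + μ i := by
    intro i
    have hsub : Finset.univ.image C.edge ⊆ F := by
      intro e he
      obtain ⟨j, -, rfl⟩ := Finset.mem_image.mp he
      exact hC j
    rw [← toRealVec_apply, ha, Finsupp.finsetSum_apply, ← Finset.sum_sdiff hsub,
      Finset.sum_eq_zero, zero_add, Finset.sum_image C.edge_injective'.injOn]
    · have : ∀ j, (c (C.edge j) • realRho (C.edge j)) (C.vert i) =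
          (if j = i then μ j else 0) + (if j + 1 = i then μ j else 0) := by
        intro j
        simp only [Finsupp.smul_apply, realRho_apply, Cycle.edge, sym2Vec_mk, Finsupp.add_apply,
          Finsupp.single_apply, C.vert_injective.eq_iff, μ, smul_eq_mul]
        split_ifs <;> push_cast <;> ring
      rw [Finset.sum_congr rfl fun j _ => this j, Finset.sum_add_distrib,
        ← C.sum_sub_one fun j k => if k = i then μ j else 0]
      simp [add_comm]
    · intro e he
      simp [realRho_apply, hother i e he]
  -- Consecutive signed coefficients have an integer sum, so modulo ℤ each step changes the sign.
  -- One turn around the odd cycle makes 2 μ i an integer, and 1/2 is the only possible coefficient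
  -- in (0, 1).
  have hint : ∀ i : Fin C.n, ∀ k : ℕ, ∃ z : ℤ, μ (i + Fin.ofNat C.n k) = (-1) ^ k * μ i + z := by
    intro i k
    induction k with
    | zero => exact ⟨0, by simp⟩
    | succ k ih =>
      obtain ⟨z, hz⟩ := ih
      have hk : Fin.ofNat C.n (k + 1) = Fin.ofNat C.n k + 1 := by
        ext; simp [Fin.ofNat, Fin.val_add]
      have := hμ (i + Fin.ofNat C.n (k + 1))
      rw [hk, ← add_assoc, add_sub_cancel_right, hz] at this
      refine ⟨a (C.vert (i + Fin.ofNat C.n k + 1)) - z, ?_⟩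
      rw [hk, ← add_assoc, pow_succ]
      push_cast
      linarith
  intro i
  refine ⟨hC i, ?_⟩
  obtain ⟨z, hz⟩ := hint i C.n
  have hn : Fin.ofNat C.n C.n = 0 := by ext; simp [Fin.ofNat]
  rw [hn, add_zero, hodd.neg_one_pow] at hz
  have c0 := h0 _ (hC i)
  have c1 := h1 _ (hC i)
  obtain ⟨y, hy⟩ : ∃ y : ℤ, 2 * c (C.edge i) = y := by
    rcases Int.units_eq_one_or (C.sgn i) with h | h
    · refine ⟨z, ?_⟩
      simp only [μ, h, Units.val_one, Int.cast_one, mul_one] at hz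
      linarith
    · refine ⟨-z, ?_⟩
      simp only [μ, h, Units.val_neg, Units.val_one, Int.cast_neg, Int.cast_one] at hz
      push_cast
      linarith
  have y0 : (0 : ℝ) < y := by linarith
  have y1 : (y : ℝ) < 2 := by linarith
  norm_cast at y0 y1
  obtain rfl : y = 1 := by omega
  push_cast at hy
  linarith

end SignedGraph

/-! ### Decomposition of cone vectors into edges and odd cycles -/

namespace SignedGraph

variable {V : Type*} {G : SignedGraph V}

/-- An integer vector in the cone of a signed graph is a sum of edge vectors and of vectors of odd
cycles. -/
lemma exists_odd_cycles [Finite V] (n : ℕ) : ∀ (F : Finset (ℤˣ × Sym2 V)), F.card = n →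
    (F : Set _) ⊆ G.edges → ∀ (c : ℤˣ × Sym2 V → ℝ), (∀ e ∈ F, 0 ≤ c e) → ∀ a : V →₀ ℤ,
    toRealVec V a = ∑ e ∈ F, c e • realRho e →
    ∃ L : Multiset G.Cycle, (∀ C ∈ L, Odd C.n) ∧
      ∃ m ∈ AddSubmonoid.closure G.rhoSet, a = m + (L.map Cycle.vec).sum := by
  classical
  induction n using Nat.strong_induction_on with
  | _ n ih =>
  intro F hn hFG c hc a ha
  subst hn
  -- An edge with coefficient zero can be dropped, and the induction hypothesis applies.
  have erase : ∀ (d : ℤˣ × Sym2 V → ℝ), (∀ e ∈ F, 0 ≤ d e) → (∃ e ∈ F, d e = 0) →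
      ∀ b : V →₀ ℤ, toRealVec V b = ∑ e ∈ F, d e • realRho e →
      ∃ L : Multiset G.Cycle, (∀ C ∈ L, Odd C.n) ∧
        ∃ m ∈ AddSubmonoid.closure G.rhoSet, b = m + (L.map Cycle.vec).sum := by
    rintro d hd ⟨e, he, hde⟩ b hb
    refine ih _ (Finset.card_erase_lt_of_mem he) (F.erase e) rfl
      (fun f hf => hFG (Finset.mem_of_mem_erase hf)) d
      (fun f hf => hd f (Finset.mem_of_mem_erase hf)) b ?_
    rw [hb, ← Finset.add_sum_erase F _ he, hde, zero_smul, zero_add]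
  let k : V →₀ ℤ := ∑ e ∈ F, ⌊c e⌋₊ • signedRho e
  have hk : k ∈ AddSubmonoid.closure G.rhoSet :=
    sum_mem fun e he => nsmul_mem (signedRho_mem_closure (hFG he)) _
  suffices ∃ L : Multiset G.Cycle, (∀ C ∈ L, Odd C.n) ∧
      ∃ m ∈ AddSubmonoid.closure G.rhoSet, a - k = m + (L.map Cycle.vec).sum by
    obtain ⟨L, hL, m, hm, h⟩ := this
    exact ⟨L, hL, k + m, add_mem hk hm, by rw [add_assoc, ← h, add_sub_cancel]⟩
  let d : ℤˣ × Sym2 V → ℝ := fun e => c e - ⌊c e⌋₊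
  have hd : toRealVec V (a - k) = ∑ e ∈ F, d e • realRho e := by
    simp only [d, k, map_sub, ha, map_sum, map_nsmul, ← Finset.sum_sub_distrib, sub_smul, realRho,
      Nat.cast_smul_eq_nsmul]
  have hd0 : ∀ e ∈ F, 0 ≤ d e := fun e he => sub_nonneg.mpr (Nat.floor_le (hc e he))
  have hd1 : ∀ e ∈ F, d e < 1 := fun e _ => by
    have := Nat.lt_floor_add_one (c e)
    simp only [d]
    linarith
  by_cases hz : ∃ e ∈ F, d e = 0
  · exact erase d hd0 hz _ hd
  push Not at hz
  have hdpos : ∀ e ∈ F, 0 < d e := fun e he => lt_of_le_of_ne (hd0 e he) (Ne.symm (hz e he))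
  rcases F.eq_empty_or_nonempty with rfl | hne
  · refine ⟨0, by simp, 0, zero_mem _, ?_⟩
    apply toRealVec_injective
    simpa using hd
  by_cases hli : LinearIndepOn ℝ realRho (F : Set (ℤˣ × Sym2 V))
  · obtain ⟨C, hodd, hC⟩ := exists_odd_cycle_half hFG hne hli hdpos hd1 hd
    have hsub : Finset.univ.image C.edge ⊆ F := by
      intro e he
      obtain ⟨j, -, rfl⟩ := Finset.mem_image.mp he
      exact (hC j).1
    have hcard : (F \ Finset.univ.image C.edge).card < F.card := by
      refine Finset.card_lt_card (Finset.sdiff_ssubset hsub ?_)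
      exact ⟨C.edge 0, Finset.mem_image_of_mem _ (Finset.mem_univ _)⟩
    -- Since all coefficients on the cycle are 1/2, removing its edges subtracts exactly the cycle
    -- vector.
    have hvec : toRealVec V C.vec = ∑ e ∈ Finset.univ.image C.edge, d e • realRho e := by
      rw [Finset.sum_image C.edge_injective'.injOn, Finset.sum_congr rfl fun i _ => by
        rw [(hC i).2], ← Finset.smul_sum]
      simp only [realRho]
      rw [← map_sum, ← C.two_smul_vec, map_zsmul, ← Int.cast_smul_eq_zsmul ℝ, smul_smul]
      norm_num
    obtain ⟨L, hL, m, hm, h⟩ := ih _ hcard (F \ Finset.univ.image C.edge) rfl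
      (fun f hf => hFG (Finset.sdiff_subset hf)) d (fun e he => hd0 e (Finset.sdiff_subset he))
      (a - k - C.vec) (by
        rw [map_sub, hd, hvec, ← Finset.sum_sdiff hsub, add_sub_cancel_right])
    refine ⟨C ::ₘ L, ?_, m, hm, ?_⟩
    · intro C' hC'
      rcases Multiset.mem_cons.mp hC' with rfl | hC'
      exacts [hodd, hL C' hC']
    · rw [Multiset.map_cons, Multiset.sum_cons, eq_add_of_sub_eq h]
      abel
  · obtain ⟨g, hg, e, he, hge⟩ : ∃ g : ℤˣ × Sym2 V → ℝ, ∑ e ∈ F, g e • realRho e = 0 ∧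
        ∃ e ∈ F, 0 < g e := by
      rw [linearIndepOn_finset_iff] at hli
      push Not at hli
      obtain ⟨g, hg, e, he, hge⟩ := hli
      rcases lt_or_gt_of_ne hge with h | h
      · exact ⟨fun e => -g e, by simp [neg_smul, hg], e, he, by simpa using h⟩
      · exact ⟨g, hg, e, he, h⟩
    -- As in Carathéodory's theorem, the smallest ratio over the positive entries of the relation is
    -- the step at which a coefficient first vanishes while all stay nonnegative. Coefficients may
    -- exceed 1 afterwards, which the induction allows.
    obtain ⟨f, hf, hmin⟩ := Finset.exists_min_image (F.filter fun e => 0 < g e)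
      (fun e => d e / g e) ⟨e, Finset.mem_filter.mpr ⟨he, hge⟩⟩
    rw [Finset.mem_filter] at hf
    have ht : 0 ≤ d f / g f := div_nonneg (hd0 f hf.1) hf.2.le
    refine erase (fun e => d e - d f / g f * g e) ?_ ⟨f, hf.1, ?_⟩ _ ?_
    · intro e he
      rcases lt_or_ge 0 (g e) with h | h
      · have := hmin e (Finset.mem_filter.mpr ⟨he, h⟩)
        rw [le_div_iff₀ h] at this
        linarith
      · have := mul_nonpos_of_nonneg_of_nonpos ht h
        have := hd0 e he
        linarith
    · rw [div_mul_cancel₀ _ hf.2.ne', sub_self]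
    · simp only [sub_smul, mul_smul, Finset.sum_sub_distrib, ← Finset.smul_sum, hg, smul_zero,
        sub_zero, hd]

/-! ### Parity on components and the pairing of odd cycles -/

/-- The sum of the coordinates in a set of vertices. -/
noncomputable def coordSum (K : Set V) : (V →₀ ℤ) →+ ℤ :=
  Finsupp.liftAddHom fun v => by
    classical exact if v ∈ K then AddMonoidHom.id ℤ else 0

open Classical in
lemma coordSum_single (K : Set V) (v : V) (z : ℤ) :
    coordSum K (Finsupp.single v z) = if v ∈ K then z else 0 := by
  rw [coordSum, Finsupp.liftAddHom_apply_single]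
  split_ifs <;> rfl

/-- The vertices that can be reached from `u`. -/
def reach (G : SignedGraph V) (u : V) : Set V := {v | Nonempty (G.Walk u v)}

lemma mem_reach_of_edge {u v w : V} {s : ℤˣ} (h : (s, s(v, w)) ∈ G.edges) (hv : v ∈ G.reach u) :
    w ∈ G.reach u :=
  hv.elim fun p => p.nonempty_concat h

lemma mem_reach_iff_of_edge {u v w : V} {s : ℤˣ} (h : (s, s(v, w)) ∈ G.edges) :
    v ∈ G.reach u ↔ w ∈ G.reach u :=
  ⟨mem_reach_of_edge h, mem_reach_of_edge (by rwa [Sym2.eq_swap])⟩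

/-- Vectors of the lattice of a signed graph have an even coordinate sum on every component. -/
lemma even_coordSum_of_mem {a : V →₀ ℤ} (ha : a ∈ AddSubgroup.closure G.rhoSet) (u : V) :
    Even (coordSum (G.reach u) a) := by
  classical
  induction ha using AddSubgroup.closure_induction with
  | mem x hx =>
    obtain ⟨⟨s, z⟩, he, rfl⟩ := hx
    induction z using Sym2.ind with
    | _ i j =>
      rw [signedRho_mk, map_zsmul, map_add, coordSum_single, coordSum_single,
        if_congr (mem_reach_iff_of_edge he) rfl rfl]
      exact (Even.add_self _).mul_left _
  | zero => simp
  | add x y _ _ hx hy => rw [map_add]; exact hx.add hy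
  | neg x _ hx => rw [map_neg]; exact hx.neg

lemma Cycle.coordSum_vec (C : G.Cycle) {K : Set V} (hK : ∀ i, C.vert i ∈ K) :
    coordSum K C.vec = ∑ i, (C.sgn i : ℤ) := by
  classical
  have h2 : 2 * coordSum K C.vec = 2 * ∑ i, (C.sgn i : ℤ) := by
    rw [← smul_eq_mul, ← map_zsmul, C.two_smul_vec, map_sum, Finset.mul_sum]
    refine Finset.sum_congr rfl fun i _ => ?_
    rw [Cycle.edge, signedRho_mk, map_zsmul, map_add, coordSum_single, coordSum_single,
      if_pos (hK _), if_pos (hK _), smul_eq_mul]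
    ring
  omega

/-- The coordinate sum is the sum of the signs of the edges, and a sum of n signs has the parity of
n. -/
lemma Cycle.odd_coordSum_vec (C : G.Cycle) (hC : Odd C.n) {K : Set V} (hK : ∀ i, C.vert i ∈ K) :
    Odd (coordSum K C.vec) := by
  have h : (2 : ℤ) ∣ ∑ i, ((C.sgn i : ℤ) - 1) := Finset.dvd_sum fun i _ => by
    rcases Int.units_eq_one_or (C.sgn i) with h | h <;> rw [h] <;> decide
  rw [Finset.sum_sub_distrib, Finset.sum_const, Finset.card_univ, Fintype.card_fin, nsmul_one] at h
  rw [C.coordSum_vec hK]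
  have := (even_iff_two_dvd.mpr h).add_odd ((Int.odd_coe_nat _).mpr hC)
  rwa [sub_add_cancel] at this

lemma Cycle.coordSum_vec_eq_zero (C : G.Cycle) {K : Set V} (hK : ∀ i, C.vert i ∉ K) :
    coordSum K C.vec = 0 := by
  classical
  rw [Cycle.vec, map_sum, Finset.sum_eq_zero]
  intro i _
  rw [coordSum_single, if_neg (hK i)]

lemma Cycle.vert_mem_reach (C : G.Cycle) (i : Fin C.n) : C.vert i ∈ G.reach (C.vert 0) := by
  have h : ∀ k : ℕ, C.vert (Fin.ofNat C.n k) ∈ G.reach (C.vert 0) := by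
    intro k
    induction k with
    | zero => exact ⟨.nil _⟩
    | succ k ih =>
      have hk : Fin.ofNat C.n (k + 1) = Fin.ofNat C.n k + 1 := by
        ext; simp [Fin.ofNat, Fin.val_add]
      rw [hk]
      exact mem_reach_of_edge (C.edge_mem _) ih
  have := h i
  rwa [show Fin.ofNat C.n i = i by ext; simp [Fin.ofNat, Nat.mod_eq_of_lt i.isLt]] at this

/-- The sum of the vectors of two odd cycles of the same component is a sum of edge vectors or the
vector of an exceptional pair. -/
lemma pairVec_mem_closure_union {P : G.Cycle × G.Cycle} (h1 : Odd P.1.n) (h2 : Odd P.2.n)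
    {i : Fin P.1.n} {j : Fin P.2.n} (p : G.Walk (P.1.vert i) (P.2.vert j)) :
    pairVec P ∈ AddSubmonoid.closure (G.rhoSet ∪ pairVec '' G.walkExceptionalPairs) := by
  by_cases halt : ∃ i j, ∃ p : G.Walk (P.1.vert i) (P.2.vert j), p.IsAlternating
  · obtain ⟨i, j, p, hp⟩ := halt
    exact AddSubmonoid.closure_mono Set.subset_union_left (pairVec_mem_closure P h1 h2 p hp)
  · refine AddSubmonoid.subset_closure (Or.inr ⟨P, ⟨⟨h1, h2, ?_, i, j, ⟨p⟩⟩, halt⟩, rfl⟩)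
    -- Cycles sharing a vertex are joined by the empty walk, which is alternating, so they are
    -- excluded here.
    rw [Set.disjoint_left]
    rintro _ ⟨i, rfl⟩ ⟨j, hj⟩
    refine halt ⟨i, j, ?_⟩
    rw [hj]
    exact ⟨.nil _, List.isChain_nil⟩

/-- A sum of vectors of odd cycles that is a lattice vector is a sum of edge vectors and of vectors
of exceptional pairs. -/
lemma sum_vec_mem_closure (n : ℕ) : ∀ L : Multiset G.Cycle, L.card = n → (∀ C ∈ L, Odd C.n) →
    (L.map Cycle.vec).sum ∈ AddSubgroup.closure G.rhoSet →
    (L.map Cycle.vec).sum ∈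
      AddSubmonoid.closure (G.rhoSet ∪ pairVec '' G.walkExceptionalPairs) := by
  induction n using Nat.strong_induction_on with
  | _ n ih =>
  intro L hn hodd hL
  induction L using Multiset.induction_on with
  | empty => simp
  | cons C L _ =>
    have hC : Odd C.n := hodd C (Multiset.mem_cons_self C L)
    -- If C were alone in its component, the coordinate sum there would be odd.
    obtain ⟨C', hC', hreach⟩ : ∃ C' ∈ L, ∃ j, C'.vert j ∈ G.reach (C.vert 0) := by
      by_contra! hno
      have heven := even_coordSum_of_mem hL (C.vert 0)
      rw [Multiset.map_cons, Multiset.sum_cons, map_add, map_multiset_sum, Multiset.map_map,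
        Multiset.sum_eq_zero, add_zero, ← Int.not_odd_iff_even] at heven
      · exact heven (C.odd_coordSum_vec hC C.vert_mem_reach)
      · intro x hx
        obtain ⟨C', hC', rfl⟩ := Multiset.mem_map.mp hx
        exact C'.coordSum_vec_eq_zero (hno C' hC')
    obtain ⟨L, rfl⟩ := Multiset.exists_cons_of_mem hC'
    obtain ⟨j, ⟨p⟩⟩ := hreach
    have hC'odd : Odd C'.n := hodd C' (Multiset.mem_cons_of_mem hC')
    have hsum : (((C ::ₘ C' ::ₘ L)).map Cycle.vec).sum =
        pairVec (C, C') + (L.map Cycle.vec).sum := by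
      simp [pairVec, add_assoc]
    have hpair := pairVec_mem_coneLattice (P := (C, C')) hC hC'odd p
    have hL' : (L.map Cycle.vec).sum ∈ AddSubgroup.closure G.rhoSet := by
      have := sub_mem hL hpair.1
      rwa [hsum, add_sub_cancel_left] at this
    rw [hsum]
    refine add_mem (pairVec_mem_closure_union (P := (C, C')) hC hC'odd p)
      (ih L.card ?_ L rfl (fun C hC => hodd C ?_) hL')
    · rw [← hn]
      simp
    · exact Multiset.mem_cons_of_mem (Multiset.mem_cons_of_mem hC)

lemma walkExceptionalPairs_subset : G.walkExceptionalPairs ⊆ G.exceptionalPairs :=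
  fun _ hP => ⟨hP.1, fun ⟨i, j, p, _, hp⟩ => hP.2 ⟨i, j, p, hp⟩⟩

lemma pairVec_mem_coneLattice_of_exceptional {P : G.Cycle × G.Cycle}
    (hP : P ∈ G.exceptionalPairs) : pairVec P ∈ coneLattice G.rhoSet := by
  obtain ⟨⟨h1, h2, -, i, j, ⟨p⟩⟩, -⟩ := hP
  exact pairVec_mem_coneLattice h1 h2 p

/-- The semigroup `ℝ₊ρ(E) ∩ ℤρ(E)` of a signed graph is generated by the edge vectors and the
vectors of the exceptional pairs. -/
theorem coneLattice_eq_closure [Finite V] : coneLattice G.rhoSet =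
    AddSubmonoid.closure (G.rhoSet ∪ pairVec '' G.walkExceptionalPairs) := by
  apply le_antisymm
  · rintro a ⟨ha, hcone⟩
    obtain ⟨F, c, hFG, hc, hac⟩ : ∃ (F : Finset (ℤˣ × Sym2 V)) (c : ℤˣ × Sym2 V → ℝ),
        (F : Set _) ⊆ G.edges ∧ (∀ e ∈ F, 0 ≤ c e) ∧
        toRealVec V a = ∑ e ∈ F, c e • realRho e := by
      have h : toRealVec V a ∈ Submodule.span ℝ≥0 (realRho '' G.edges) := by
        have h' : toRealVec V '' G.rhoSet = realRho '' G.edges := by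
          rw [rhoSet, Set.image_image]
          rfl
        rw [← h']
        exact hcone
      obtain ⟨l, hl, hla⟩ := (Finsupp.mem_span_image_iff_linearCombination ℝ≥0).mp h
      refine ⟨l.support, fun e => l e, (Finsupp.mem_supported _ _).mp hl, fun e _ => (l e).2, ?_⟩
      rw [← hla, Finsupp.linearCombination_apply, Finsupp.sum]
      rfl
    obtain ⟨L, hodd, m, hm, rfl⟩ := exists_odd_cycles _ F rfl hFG c hc a hac
    refine add_mem (AddSubmonoid.closure_mono Set.subset_union_left hm)
      (sum_vec_mem_closure _ L rfl hodd ?_)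
    have ha' : _ ∈ AddSubgroup.closure G.rhoSet := ha
    have hm' : m ∈ AddSubgroup.closure G.rhoSet := closure_rhoSet_le_lattice hm
    have := sub_mem ha' hm'
    rwa [add_sub_cancel_left] at this
  · rw [AddSubmonoid.closure_le]
    rintro _ (h | ⟨P, hP, rfl⟩)
    · exact closure_le_coneLattice _ (AddSubmonoid.subset_closure h)
    · exact pairVec_mem_coneLattice_of_exceptional (walkExceptionalPairs_subset hP)

/-- Twice a vector of `ℝ₊ρ(E) ∩ ℤρ(E)` is a sum of edge vectors. -/
lemma two_smul_mem_closure [Finite V] {a : V →₀ ℤ} (ha : a ∈ coneLattice G.rhoSet) :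
    2 • a ∈ AddSubmonoid.closure G.rhoSet := by
  rw [coneLattice_eq_closure] at ha
  induction ha using AddSubmonoid.closure_induction with
  | mem x hx =>
    rcases hx with hx | ⟨P, -, rfl⟩
    · exact nsmul_mem (AddSubmonoid.subset_closure hx) _
    · have h : ∀ C : G.Cycle, 2 • C.vec ∈ AddSubmonoid.closure G.rhoSet := by
        intro C
        have := C.two_smul_vec
        rw [ofNat_zsmul] at this
        rw [this]
        exact sum_mem fun i _ => signedRho_mem_closure (C.edge_mem' i)
      rw [pairVec, nsmul_add]
      exact add_mem (h _) (h _)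
  | zero => simp
  | add x y _ _ hx hy => rw [nsmul_add]; exact add_mem hx hy

end SignedGraph

/-! ### Monomial algebras -/

section MonomialAlgebra

variable {k V W : Type*} [Field k]

lemma xpow_zero : xpow k (0 : V →₀ ℤ) = 1 := rfl

lemma xpow_add (a b : V →₀ ℤ) : xpow k (a + b) = xpow k a * xpow k b := by
  simp [xpow, AddMonoidAlgebra.single_mul_single]

lemma xpow_sum {ι : Type*} (s : Finset ι) (f : ι → V →₀ ℤ) :
    xpow k (∑ i ∈ s, f i) = ∏ i ∈ s, xpow k (f i) := by
  classical
  induction s using Finset.induction_on with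
  | empty => simp [xpow_zero]
  | insert i s hi ih => rw [Finset.sum_insert hi, Finset.prod_insert hi, xpow_add, ih]

lemma xpow_mem_monomialAlgebra {R : Set (V →₀ ℤ)} {a : V →₀ ℤ}
    (ha : a ∈ AddSubmonoid.closure R) : xpow k a ∈ monomialAlgebra k R := by
  induction ha using AddSubmonoid.closure_induction with
  | mem x hx => exact Algebra.subset_adjoin ⟨x, hx, rfl⟩
  | zero => exact one_mem _
  | add x y _ _ hx hy => rw [xpow_add]; exact mul_mem hx hy

lemma monomialAlgebra_le {R R' : Set (V →₀ ℤ)} (h : R ⊆ AddSubmonoid.closure R') :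
    monomialAlgebra k R ≤ monomialAlgebra k R' := by
  refine Algebra.adjoin_le ?_
  rintro _ ⟨a, ha, rfl⟩
  exact xpow_mem_monomialAlgebra (h ha)

lemma monomialAlgebra_closure (R : Set (V →₀ ℤ)) :
    monomialAlgebra k (AddSubmonoid.closure R : Set (V →₀ ℤ)) = monomialAlgebra k R :=
  le_antisymm (monomialAlgebra_le subset_rfl)
    (monomialAlgebra_le fun _ ha => AddSubmonoid.subset_closure (AddSubmonoid.subset_closure ha))

lemma mapDomainAlgHom_xpow (f : (V →₀ ℤ) →+ (W →₀ ℤ)) (a : V →₀ ℤ) :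
    AddMonoidAlgebra.mapDomainAlgHom k k f (xpow k a) = xpow k (f a) := by
  simp [xpow]

lemma monomialAlgebra_map (f : (V →₀ ℤ) →+ (W →₀ ℤ)) (R : Set (V →₀ ℤ)) :
    (monomialAlgebra k R).map (AddMonoidAlgebra.mapDomainAlgHom k k f) =
      monomialAlgebra k (f '' R) := by
  rw [monomialAlgebra, monomialAlgebra, AlgHom.map_adjoin, Set.image_image, Set.image_image]
  simp only [mapDomainAlgHom_xpow]

lemma generatedOver_adjoin {L : Type*} [CommRing L] [Algebra k L] (s t : Set L) :
    generatedOver (Algebra.adjoin k s) t = Algebra.adjoin k (s ∪ t) :=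
  (Algebra.adjoin_union_eq_adjoin_adjoin k s t).symm

lemma generatedOver_map {L M : Type*} [CommRing L] [Algebra k L] [CommRing M] [Algebra k M]
    (R : Subalgebra k L) (S : Set L) (f : L →ₐ[k] M) :
    (generatedOver R S).map f = generatedOver (R.map f) (f '' S) := by
  obtain ⟨s, rfl⟩ : ∃ s, R = Algebra.adjoin k s := ⟨R, (Algebra.adjoin_eq R).symm⟩
  rw [generatedOver_adjoin, AlgHom.map_adjoin, AlgHom.map_adjoin, generatedOver_adjoin,
    Set.image_union]

/-- Additive maps between lattices are compatible with the semigroups `ℝ₊R ∩ ℤR`. -/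
lemma map_mem_coneLattice (f : (V →₀ ℤ) →+ (W →₀ ℤ)) {R : Set (V →₀ ℤ)} {R' : Set (W →₀ ℤ)}
    (h : ∀ a ∈ R, f a ∈ coneLattice R') {a : V →₀ ℤ} (ha : a ∈ coneLattice R) :
    f a ∈ coneLattice R' := by
  refine ⟨?_, ?_⟩
  · have hle : AddSubgroup.closure R ≤ (AddSubgroup.closure R').comap f :=
      (AddSubgroup.closure_le _).mpr fun a ha => (h a ha).1
    exact hle ha.1
  · let g : (V →₀ ℝ) →ₗ[ℝ] (W →₀ ℝ) :=
      Finsupp.linearCombination ℝ fun v => toRealVec W (f (Finsupp.single v 1))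
    have hg : ∀ a, g (toRealVec V a) = toRealVec W (f a) := by
      intro a
      suffices g.toAddMonoidHom.comp (toRealVec V) = (toRealVec W).comp f from
        DFunLike.congr_fun this a
      ext v : 2
      simp [g, toRealVec]
    have hle : Submodule.span ℝ≥0 (toRealVec V '' R) ≤
        (Submodule.span ℝ≥0 (toRealVec W '' R')).comap (g.restrictScalars ℝ≥0) := by
      rw [Submodule.span_le]
      rintro _ ⟨a, ha, rfl⟩
      change g (toRealVec V a) ∈ Submodule.span ℝ≥0 (toRealVec W '' R')
      rw [hg]
      exact (h a ha).2
    have := hle ha.2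
    change g (toRealVec V a) ∈ Submodule.span ℝ≥0 (toRealVec W '' R') at this
    rwa [hg] at this

end MonomialAlgebra

/-! ### Generators of the normalization for signed graphs -/

namespace SignedGraph

variable {k V : Type*} [Field k] {G : SignedGraph V}

lemma Cycle.monomial_eq (C : G.Cycle) : C.monomial k = xpow k C.vec := by
  rw [Cycle.monomial, Cycle.vec, xpow_sum]

lemma pairMonomial_eq (P : G.Cycle × G.Cycle) : pairMonomial k P = xpow k (pairVec P) := by
  rw [pairMonomial, pairVec, xpow_add, Cycle.monomial_eq, Cycle.monomial_eq]

/-- The normalization of the edge ring of a signed graph is generated by the monomials of the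
exceptional pairs. -/
theorem ehrhartRing_eq_generatedOver [Finite V] (G : SignedGraph V) {S : Set (G.Cycle × G.Cycle)}
    (h1 : G.walkExceptionalPairs ⊆ S) (h2 : S ⊆ G.exceptionalPairs) :
    G.ehrhartRing k = generatedOver (G.edgeRing k) (pairMonomial k '' S) := by
  have hS : pairMonomial k '' S = xpow k '' (pairVec '' S) := by
    rw [Set.image_image]
    simp only [pairMonomial_eq]
  -- The smaller family of exceptional pairs already generates, and the larger one stays in the
  -- semigroup, so every family in between works.
  have hcone : coneLattice G.rhoSet = AddSubmonoid.closure (G.rhoSet ∪ pairVec '' S) := by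
    apply le_antisymm
    · rw [coneLattice_eq_closure]
      exact AddSubmonoid.closure_mono (Set.union_subset_union_right _ (Set.image_mono h1))
    · rw [AddSubmonoid.closure_le]
      rintro _ (h | ⟨P, hP, rfl⟩)
      · exact closure_le_coneLattice _ (AddSubmonoid.subset_closure h)
      · exact pairVec_mem_coneLattice_of_exceptional (h2 hP)
  rw [ehrhartRing, hcone, monomialAlgebra_closure, edgeRing, monomialAlgebra, monomialAlgebra,
    generatedOver_adjoin, hS, Set.image_union]

end SignedGraph

/-! ### The augmented graph -/

namespace MixedGraph

variable {k V : Type*} [Field k] (G : MixedGraph V)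

/-- The retraction of `ℤ^{V ⊔ T}` onto `ℤ^V` that sends `e_{t_p}` to `-e_i` for `p = (i, j)`. It
sends the edges of the augmented graph to `0` or to edges of `G`. -/
noncomputable def retraction : (V ⊕ G.arcs →₀ ℤ) →+ (V →₀ ℤ) :=
  Finsupp.liftAddHom (Sum.elim (fun v => Finsupp.singleAddHom v)
    fun p => -(Finsupp.singleAddHom p.1.1 : ℤ →+ V →₀ ℤ))

@[simp] lemma retraction_single_inl (v : V) (z : ℤ) :
    G.retraction (Finsupp.single (Sum.inl v) z) = Finsupp.single v z := by
  rw [retraction, Finsupp.liftAddHom_apply_single]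
  rfl

@[simp] lemma retraction_single_inr (p : G.arcs) (z : ℤ) :
    G.retraction (Finsupp.single (Sum.inr p) z) = -Finsupp.single p.1.1 z := by
  rw [retraction, Finsupp.liftAddHom_apply_single]
  rfl

/-- The inclusion `ℤ^V → ℤ^{V ⊔ T}`. -/
noncomputable def inclusion : (V →₀ ℤ) →+ (V ⊕ G.arcs →₀ ℤ) :=
  Finsupp.mapDomain.addMonoidHom Sum.inl

@[simp] lemma inclusion_single (v : V) (z : ℤ) :
    G.inclusion (Finsupp.single v z) = Finsupp.single (Sum.inl v) z :=
  Finsupp.mapDomain_single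

lemma retraction_inclusion (a : V →₀ ℤ) : G.retraction (G.inclusion a) = a := by
  suffices G.retraction.comp G.inclusion = AddMonoidHom.id _ from DFunLike.congr_fun this a
  ext v : 2
  simp

lemma inclusion_signedRho (s : ℤˣ) (z : Sym2 V) :
    G.inclusion (signedRho (s, z)) = signedRho (s, z.map Sum.inl) := by
  induction z using Sym2.ind with
  | _ i j => simp [signedRho_mk]

lemma retraction_rhoSet {a : V ⊕ G.arcs →₀ ℤ} (ha : a ∈ G.augmented.rhoSet) :
    G.retraction a = 0 ∨ G.retraction a ∈ G.rhoSet := by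
  obtain ⟨e, he, rfl⟩ := ha
  rcases he with ⟨f, hf, rfl⟩ | ⟨p, rfl | rfl⟩
  · right
    rw [← G.inclusion_signedRho, retraction_inclusion]
    exact Or.inl ⟨f, hf, rfl⟩
  · left
    simp [signedRho_mk]
  · right
    refine Or.inr ⟨p.1, p.2, ?_⟩
    simp [signedRho_mk, arcRho, sub_eq_neg_add]

lemma retraction_rhoSet_mem_closure {a : V ⊕ G.arcs →₀ ℤ} (ha : a ∈ G.augmented.rhoSet) :
    G.retraction a ∈ AddSubmonoid.closure G.rhoSet := by
  rcases G.retraction_rhoSet ha with h | h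
  · rw [h]; exact zero_mem _
  · exact AddSubmonoid.subset_closure h

lemma inclusion_rhoSet_mem_closure {a : V →₀ ℤ} (ha : a ∈ G.rhoSet) :
    G.inclusion a ∈ AddSubmonoid.closure G.augmented.rhoSet := by
  rcases ha with ⟨⟨s, z⟩, he, rfl⟩ | ⟨p, hp, rfl⟩
  · rw [inclusion_signedRho]
    exact SignedGraph.signedRho_mem_closure (Or.inl ⟨(s, z), he, rfl⟩)
  · have h1 := SignedGraph.signedRho_mem_closure (G := G.augmented)
      (Or.inr ⟨⟨p, hp⟩, Or.inl rfl⟩)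
    have h2 := SignedGraph.signedRho_mem_closure (G := G.augmented)
      (Or.inr ⟨⟨p, hp⟩, Or.inr rfl⟩)
    convert add_mem h1 h2 using 1
    simp only [arcRho, map_sub, inclusion_single, signedRho_mk, Units.val_neg, Units.val_one,
      neg_smul, one_smul]
    abel

lemma retraction_mem_coneLattice {a : V ⊕ G.arcs →₀ ℤ}
    (ha : a ∈ coneLattice G.augmented.rhoSet) : G.retraction a ∈ coneLattice G.rhoSet :=
  map_mem_coneLattice _
    (fun _ hb => closure_le_coneLattice _ (G.retraction_rhoSet_mem_closure hb)) ha

lemma inclusion_mem_coneLattice {a : V →₀ ℤ} (ha : a ∈ coneLattice G.rhoSet) :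
    G.inclusion a ∈ coneLattice G.augmented.rhoSet :=
  map_mem_coneLattice _
    (fun _ hb => closure_le_coneLattice _ (G.inclusion_rhoSet_mem_closure hb)) ha

/-- Twice a vector of `ℝ₊ρ(E) ∩ ℤρ(E)` is a sum of edge vectors. -/
lemma two_smul_mem_closure [Finite V] {a : V →₀ ℤ} (ha : a ∈ coneLattice G.rhoSet) :
    2 • a ∈ AddSubmonoid.closure G.rhoSet := by
  have h := SignedGraph.two_smul_mem_closure (G.inclusion_mem_coneLattice ha)
  have hle : AddSubmonoid.closure G.augmented.rhoSet ≤
      (AddSubmonoid.closure G.rhoSet).comap G.retraction :=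
    AddSubmonoid.closure_le.mpr fun _ => G.retraction_rhoSet_mem_closure
  have := hle h
  rwa [AddSubmonoid.mem_comap, map_nsmul, retraction_inclusion] at this

/-- The retraction respects the two semigroups, and it is onto because `inclusion` is a section that
respects them too. -/
lemma ehrhartRing_augmented_map : (G.augmented.ehrhartRing k).map
    (AddMonoidAlgebra.mapDomainAlgHom k k G.retraction) = G.ehrhartRing k := by
  rw [SignedGraph.ehrhartRing, ehrhartRing, monomialAlgebra_map]
  congr 1
  apply Set.Subset.antisymm
  · rintro _ ⟨a, ha, rfl⟩
    exact G.retraction_mem_coneLattice ha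
  · intro a ha
    exact ⟨_, G.inclusion_mem_coneLattice ha, G.retraction_inclusion a⟩

lemma edgeRing_augmented_map : (G.augmented.edgeRing k).map
    (AddMonoidAlgebra.mapDomainAlgHom k k G.retraction) = G.edgeRing k := by
  rw [SignedGraph.edgeRing, edgeRing, monomialAlgebra_map]
  apply le_antisymm
  · refine monomialAlgebra_le ?_
    rintro _ ⟨a, ha, rfl⟩
    exact G.retraction_rhoSet_mem_closure ha
  · rw [← monomialAlgebra_closure (G.retraction '' _)]
    refine monomialAlgebra_le fun a ha => AddSubmonoid.subset_closure ?_
    rw [← AddMonoidHom.map_mclosure]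
    exact ⟨_, G.inclusion_rhoSet_mem_closure ha, G.retraction_inclusion a⟩

/-- The signature of an artificial vertex in a cycle is zero. -/
lemma sig_eq_zero_of_inr (C : G.augmented.Cycle) {i : Fin C.n} {p : G.arcs}
    (hi : C.vert i = Sum.inr p) : C.sig i = 0 := by
  have key : ∀ (s : ℤˣ) (x : V ⊕ G.arcs), (s, s(x, Sum.inr p)) ∈ G.augmented.edges →
      (s = -1 ∧ x = Sum.inl p.1.1) ∨ (s = 1 ∧ x = Sum.inl p.1.2) := by
    rintro s x (⟨⟨t, z⟩, -, h⟩ | ⟨q, h | h⟩)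
    · induction z using Sym2.ind with
      | _ a b => simp at h
    · simp only [Prod.mk.injEq, Sym2.eq_iff, Sum.inr.injEq, reduceCtorEq, and_false, or_false] at h
      obtain ⟨rfl, rfl, rfl⟩ := h
      exact Or.inl ⟨rfl, rfl⟩
    · simp only [Prod.mk.injEq, Sym2.eq_iff, Sum.inr.injEq, reduceCtorEq, and_false, false_or] at h
      obtain ⟨rfl, rfl, rfl⟩ := h
      exact Or.inr ⟨rfl, rfl⟩
  have hin := C.edge_mem (i - 1)
  have hout := C.edge_mem i
  rw [sub_add_cancel, hi] at hin
  rw [hi, Sym2.eq_swap] at hout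
  -- The only edges at t_p are one negative and one positive edge. Equal signs would mean that the
  -- cycle uses the same edge on both sides of t_p, hence that it is a loop there, and no such loop
  -- exists.
  have hne : C.sgn (i - 1) ≠ C.sgn i := by
    intro hs
    have hv : C.vert (i - 1) = C.vert (i + 1) := by
      rcases key _ _ hin with ⟨h1, h2⟩ | ⟨h1, h2⟩ <;> rcases key _ _ hout with ⟨h3, h4⟩ | ⟨h3, h4⟩
      · rw [h2, h4]
      · rw [h1, h3] at hs; exact absurd hs (by decide)
      · rw [h1, h3] at hs; exact absurd hs (by decide)
      · rw [h2, h4]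
    have hidx : i - 1 = i := C.edge_injective (by
      simp only [hs, sub_add_cancel, hv]
      rw [Sym2.eq_swap])
    rw [hidx, hi] at hin
    rcases key _ _ hin with ⟨-, h⟩ | ⟨-, h⟩ <;> simp at h
  rw [SignedGraph.Cycle.sig, Int.units_ne_iff_eq_neg.mp hne]
  simp

/-- Artificial vertices do not occur in the cycle vector, and on the original vertices nothing is
changed. -/
lemma inclusion_retraction_vec (C : G.augmented.Cycle) :
    G.inclusion (G.retraction C.vec) = C.vec := by
  rw [SignedGraph.Cycle.vec, map_sum, map_sum]
  refine Finset.sum_congr rfl fun i _ => ?_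
  rcases h : C.vert i with v | p
  · simp
  · simp [G.sig_eq_zero_of_inr C h]

lemma laurentInl_retraction_pairMonomial (P : G.augmented.Cycle × G.augmented.Cycle) :
    laurentInl k V G.arcs (AddMonoidAlgebra.mapDomainAlgHom k k G.retraction
      (SignedGraph.pairMonomial k P)) = SignedGraph.pairMonomial k P := by
  rw [SignedGraph.pairMonomial_eq, mapDomainAlgHom_xpow, laurentInl, mapDomainAlgHom_xpow]
  change xpow k (G.inclusion _) = _
  rw [SignedGraph.pairVec, map_add, map_add, inclusion_retraction_vec, inclusion_retraction_vec]

/-- A family of pairs of cycles that generates the normalization of the edge ring of the augmented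
graph also generates that of the edge ring of `G`. -/
theorem ehrhartRing_map_eq_of_augmented (S : Set (G.augmented.Cycle × G.augmented.Cycle))
    (h : G.augmented.ehrhartRing k =
      generatedOver (G.augmented.edgeRing k) (SignedGraph.pairMonomial k '' S)) :
    (G.ehrhartRing k).map (laurentInl k V G.arcs) =
      generatedOver ((G.edgeRing k).map (laurentInl k V G.arcs))
        (SignedGraph.pairMonomial k '' S) := by
  rw [← ehrhartRing_augmented_map, ← edgeRing_augmented_map, h, generatedOver_map,
    generatedOver_map, Set.image_image, Set.image_image]
  simp only [laurentInl_retraction_pairMonomial]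

end MixedGraph

/-! ### Farkas' lemma -/

/-- **Farkas' lemma**: a vector outside the cone generated by finitely many vectors is separated
from it by a linear form. -/
theorem exists_dual_nonneg_and_neg {E ι : Type*} [AddCommGroup E] [Module ℝ E] (s : Finset ι) :
    ∀ (v : ι → E) (b : E), (∀ c : ι → ℝ, (∀ i ∈ s, 0 ≤ c i) → ∑ i ∈ s, c i • v i ≠ b) →
    ∃ φ : E →ₗ[ℝ] ℝ, (∀ i ∈ s, 0 ≤ φ (v i)) ∧ φ b < 0 := by
  classical
  induction s using Finset.induction_on with
  | empty =>
    intro v b hb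
    have hb0 : b ≠ 0 := fun h => hb 0 (by simp) (by simp [h])
    obtain ⟨φ, hφ⟩ : ∃ φ : Module.Dual ℝ E, φ b ≠ 0 := by
      by_contra! h
      exact hb0 ((Module.forall_dual_apply_eq_zero_iff ℝ b).mp h)
    rcases lt_or_gt_of_ne hφ with h | h
    · exact ⟨φ, by simp, h⟩
    · exact ⟨-φ, by simp, by simpa using h⟩
  | insert j s hj ih =>
    intro v b hb
    obtain ⟨φ, hφ, hφb⟩ := ih v b fun c hc h => hb (fun i => if i = j then 0 else c i)
      (fun i hi => by
        split_ifs with hij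
        · rfl
        · exact hc i ((Finset.mem_insert.mp hi).resolve_left hij)) (by
        rw [Finset.sum_insert hj, if_pos rfl, zero_smul, zero_add, ← h]
        refine Finset.sum_congr rfl fun i hi => ?_
        rw [if_neg (by rintro rfl; exact hj hi)])
    rcases le_or_gt 0 (φ (v j)) with hvj | hvj
    · exact ⟨φ, Finset.forall_mem_insert _ _ _ |>.mpr ⟨hvj, hφ⟩, hφb⟩
    -- P is the projection onto the kernel of φ along `v j`. A form separating the projected
    -- vectors, composed with P, vanishes on `v j` and separates the original ones.
    · let P : E →ₗ[ℝ] E := LinearMap.id - (φ.smulRight ((φ (v j))⁻¹ • v j))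
      have hP : ∀ x, P x = x - (φ x * (φ (v j))⁻¹) • v j := fun x => by
        simp [P, smul_smul]
      obtain ⟨ψ, hψ, hψb⟩ := ih (fun i => P (v i)) (P b) fun c hc h => by
        -- The coefficient of `v j` is what the projection discarded; the signs of φ on b, `v j` and
        -- the other vectors make it nonnegative.
        refine hb (fun i => if i = j then φ b * (φ (v j))⁻¹ - ∑ i ∈ s, c i * (φ (v i) * (φ (v j))⁻¹)
          else c i) ?_ ?_
        · intro i hi
          split_ifs with hij
          · have h1 : 0 ≤ φ b * (φ (v j))⁻¹ :=
              (mul_pos_of_neg_of_neg hφb (inv_lt_zero.mpr hvj)).le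
            have h2 : ∑ i ∈ s, c i * (φ (v i) * (φ (v j))⁻¹) ≤ 0 :=
              Finset.sum_nonpos fun i hi => mul_nonpos_of_nonneg_of_nonpos (hc i hi)
                (mul_nonpos_of_nonneg_of_nonpos (hφ i hi) (inv_lt_zero.mpr hvj).le)
            linarith
          · exact hc i ((Finset.mem_insert.mp hi).resolve_left hij)
        · rw [Finset.sum_insert hj, if_pos rfl]
          have h3 : ∑ i ∈ s, (if i = j then φ b * (φ (v j))⁻¹ -
              ∑ i ∈ s, c i * (φ (v i) * (φ (v j))⁻¹) else c i) • v i = ∑ i ∈ s, c i • v i :=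
            Finset.sum_congr rfl fun i hi => by
              rw [if_neg (by rintro rfl; exact hj hi)]
          rw [h3]
          simp only [hP, smul_sub, smul_smul, Finset.sum_sub_distrib, ← Finset.sum_smul] at h
          rw [eq_sub_iff_add_eq] at h
          rw [sub_smul]
          refine Eq.trans ?_ h
          abel
      refine ⟨ψ.comp P, Finset.forall_mem_insert _ _ _ |>.mpr ⟨?_, hψ⟩, hψb⟩
      rw [LinearMap.comp_apply, hP, mul_inv_cancel₀ hvj.ne, one_smul, sub_self, map_zero]

/-! ### Supports of Laurent polynomials -/

section Support

variable {k V : Type*} [Field k]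

lemma mem_support_mul {f g : Laurent k V} {a : V →₀ ℤ} (h : a ∈ (f * g).coeff.support) :
    ∃ b ∈ f.coeff.support, ∃ c ∈ g.coeff.support, b + c = a := by
  classical
  exact Finset.mem_add.mp (AddMonoidAlgebra.support_coeff_mul_subset f g h)

lemma support_subset_of_mem_monomialAlgebra {R : Set (V →₀ ℤ)} {f : Laurent k V}
    (hf : f ∈ monomialAlgebra k R) : ∀ a ∈ f.coeff.support, a ∈ AddSubmonoid.closure R := by
  classical
  induction hf using Algebra.adjoin_induction with
  | mem x hx =>
    obtain ⟨b, hb, rfl⟩ := hx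
    intro a ha
    have := Finsupp.support_single_subset ha
    rw [Finset.mem_singleton.mp this]
    exact AddSubmonoid.subset_closure hb
  | algebraMap r =>
    intro a ha
    have := Finsupp.support_single_subset (a := (0 : V →₀ ℤ)) (b := r) ha
    rw [Finset.mem_singleton.mp this]
    exact zero_mem _
  | add x y _ _ hx hy =>
    intro a ha
    rcases Finset.mem_union.mp (Finsupp.support_add ha) with h | h
    exacts [hx a h, hy a h]
  | mul x y _ _ hx hy =>
    intro a ha
    obtain ⟨b, hb, c, hc, rfl⟩ := mem_support_mul ha
    exact add_mem (hx b hb) (hy c hc)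

lemma mem_monomialAlgebra_of_support {R : Set (V →₀ ℤ)} {f : Laurent k V}
    (hf : ∀ a ∈ f.coeff.support, a ∈ AddSubmonoid.closure R) : f ∈ monomialAlgebra k R := by
  have h : f = ∑ a ∈ f.coeff.support, f.coeff a • xpow k a := by
    conv_lhs => rw [← f.sum_coeff_single]
    refine Finset.sum_congr rfl fun a _ => ?_
    rw [xpow, AddMonoidAlgebra.smul_single, smul_eq_mul, mul_one]
  rw [h]
  exact sum_mem fun a ha => Subalgebra.smul_mem _ (xpow_mem_monomialAlgebra (hf a ha)) _

/-- The exponents of `f` all satisfy `r ≤ φ`. -/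
def SupportGE (φ : (V →₀ ℤ) →+ ℝ) (r : ℝ) (f : Laurent k V) : Prop :=
  ∀ a ∈ f.coeff.support, r ≤ φ a

lemma SupportGE.mono {φ : (V →₀ ℤ) →+ ℝ} {r s : ℝ} {f : Laurent k V} (h : SupportGE φ r f)
    (hs : s ≤ r) : SupportGE φ s f :=
  fun a ha => hs.trans (h a ha)

lemma SupportGE.mul {φ : (V →₀ ℤ) →+ ℝ} {r s : ℝ} {f g : Laurent k V} (hf : SupportGE φ r f)
    (hg : SupportGE φ s g) : SupportGE φ (r + s) (f * g) := by
  intro a ha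
  obtain ⟨b, hb, c, hc, rfl⟩ := mem_support_mul ha
  rw [map_add]
  exact add_le_add (hf b hb) (hg c hc)

lemma SupportGE.add {φ : (V →₀ ℤ) →+ ℝ} {r : ℝ} {f g : Laurent k V} (hf : SupportGE φ r f)
    (hg : SupportGE φ r g) : SupportGE φ r (f + g) := by
  classical
  intro a ha
  rcases Finset.mem_union.mp (Finsupp.support_add ha) with h | h
  exacts [hf a h, hg a h]

lemma SupportGE.neg {φ : (V →₀ ℤ) →+ ℝ} {r : ℝ} {f : Laurent k V} (hf : SupportGE φ r f) :
    SupportGE φ r (-f) := by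
  intro a ha
  refine hf a ?_
  rw [Finsupp.mem_support_iff] at ha ⊢
  simpa using ha

lemma supportGE_zero (φ : (V →₀ ℤ) →+ ℝ) (r : ℝ) : SupportGE φ r (0 : Laurent k V) := by
  intro a ha
  simp at ha

lemma SupportGE.sum {φ : (V →₀ ℤ) →+ ℝ} {r : ℝ} {ι : Type*} {s : Finset ι}
    {f : ι → Laurent k V} (hf : ∀ i ∈ s, SupportGE φ r (f i)) :
    SupportGE φ r (∑ i ∈ s, f i) :=
  Finset.sum_induction f (SupportGE φ r) (fun _ _ => SupportGE.add) (supportGE_zero φ r) hf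

lemma SupportGE.pow {φ : (V →₀ ℤ) →+ ℝ} {r : ℝ} {f : Laurent k V} (hf : SupportGE φ r f)
    (n : ℕ) : SupportGE φ (n * r) (f ^ n) := by
  induction n with
  | zero =>
    intro a ha
    have := Finsupp.support_single_subset (a := (0 : V →₀ ℤ)) (b := (1 : k)) ha
    rw [Finset.mem_singleton.mp this]
    simp
  | succ n ih =>
    rw [pow_succ]
    convert ih.mul hf using 1
    push_cast
    ring

/-- A half-space condition on the exponents of the elements of `A` extends to the Laurent
polynomials that are integral over `A`. -/
lemma supportGE_of_isIntegral {φ : (V →₀ ℤ) →+ ℝ} {A : Subalgebra k (Laurent k V)}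
    (hA : ∀ f ∈ A, SupportGE φ 0 f) {f : Laurent k V} (hf : IsIntegral A f) :
    SupportGE φ 0 f := by
  classical
  by_contra hneg
  simp only [SupportGE] at hneg
  push Not at hneg
  obtain ⟨a₁, ha₁, hneg⟩ := hneg
  obtain ⟨a₀, ha₀, hmin⟩ := Finset.exists_min_image f.coeff.support φ ⟨a₁, ha₁⟩
  set m := φ a₀ with hm
  have hm0 : m < 0 := (hmin a₁ ha₁).trans_lt hneg
  -- φ is real-valued, so the gap above its minimum m comes from finiteness of the support. The
  -- bound ε ≤ -m gives d m + ε ≤ (d - 1) m below.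
  obtain ⟨ε, hε, hεm, hgap⟩ : ∃ ε, 0 < ε ∧ ε ≤ -m ∧
      ∀ a ∈ f.coeff.support, φ a ≠ m → m + ε ≤ φ a := by
    rcases (f.coeff.support.filter fun a => φ a ≠ m).eq_empty_or_nonempty with h | h
    · refine ⟨-m, by linarith, le_rfl, fun a ha hne => ?_⟩
      exact absurd (Finset.mem_filter.mpr ⟨ha, hne⟩) (by rw [h]; simp)
    · obtain ⟨b, hb, hbmin⟩ := Finset.exists_min_image _ φ h
      rw [Finset.mem_filter] at hb
      have hbm : m < φ b := lt_of_le_of_ne (hmin b hb.1) (Ne.symm hb.2)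
      refine ⟨min (-m) (φ b - m), lt_min (by linarith) (by linarith), min_le_left _ _, ?_⟩
      intro a ha hne
      have h1 := hbmin a (Finset.mem_filter.mpr ⟨ha, hne⟩)
      have h2 := min_le_right (-m) (φ b - m)
      linarith
  let g : Laurent k V := .ofCoeff (f.coeff.filter fun a => φ a = m)
  have hsplit : f - g = .ofCoeff (f.coeff.filter fun a => ¬ φ a = m) := by
    rw [sub_eq_iff_eq_add']
    apply AddMonoidAlgebra.coeff_injective
    exact (Finsupp.filter_add_filter_not f.coeff _).symm
  have hfm : SupportGE φ m f := hmin
  have hgm : ∀ a ∈ g.coeff.support, φ a = m := fun a ha => by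
    simp only [g, Finsupp.support_filter, Finset.mem_filter] at ha
    exact ha.2
  have hfg : SupportGE φ (m + ε) (f - g) := by
    rw [hsplit]
    intro a ha
    simp only [Finsupp.support_filter, Finset.mem_filter] at ha
    exact hgap a ha.1 ha.2
  have hg0 : g ≠ 0 := by
    intro h
    have h1 : g.coeff a₀ = f.coeff a₀ := Finsupp.filter_apply_pos _ _ rfl
    rw [h] at h1
    exact (Finsupp.mem_support_iff.mp ha₀) h1.symm
  obtain ⟨p, hp, hpe⟩ := hf
  rw [Polynomial.eval₂_eq_sum_range, Finset.sum_range_succ, hp.coeff_natDegree, map_one,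
    one_mul] at hpe
  set d := p.natDegree
  -- The integral equation expresses f ^ d through lower powers with coefficients in A; as m < 0,
  -- the worst exponent is d - 1.
  have hfd : SupportGE φ (((d : ℝ) - 1) * m) (f ^ d) := by
    rw [eq_neg_of_add_eq_zero_right hpe]
    refine (SupportGE.sum fun i hi => ?_).neg
    have hi : (i : ℝ) + 1 ≤ d := by exact_mod_cast Finset.mem_range.mp hi
    refine ((hA _ (p.coeff i).2).mul (hfm.pow i)).mono ?_
    nlinarith
  have hdiff : SupportGE φ (d * m + ε) (f ^ d - g ^ d) := by
    rw [← (Commute.all f g).mul_geom_sum₂]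
    refine (hfg.mul (SupportGE.sum (r := ((d : ℝ) - 1) * m) fun i hi => ?_)).mono
      (by ring_nf; rfl)
    have hi := Finset.mem_range.mp hi
    convert (hfm.pow i).mul (SupportGE.pow (fun a ha => (hgm a ha).ge) (d - 1 - i)) using 1
    rw [Nat.sub_sub, Nat.cast_sub (by omega)]
    push_cast
    ring
  -- The lowest part g has φ = m throughout, so the nonzero g ^ d lives exactly at d m,
  -- contradicting this bound.
  have hgd : SupportGE φ (d * m + ε) (g ^ d) := by
    rw [← sub_sub_cancel (f ^ d) (g ^ d), sub_eq_add_neg]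
    exact (hfd.mono (by nlinarith)).add hdiff.neg
  have hgd' : SupportGE (-φ) (d * -m) (g ^ d) :=
    SupportGE.pow (fun a ha => by simp [hgm a ha]) d
  obtain ⟨a, ha⟩ : (g ^ d).coeff.support.Nonempty := by
    rw [Finsupp.support_nonempty_iff]
    exact fun h => pow_ne_zero d hg0 (AddMonoidAlgebra.coeff_injective h)
  have h1 := hgd a ha
  have h2 := hgd' a ha
  rw [AddMonoidHom.neg_apply] at h2
  linarith

/-- If a nonzero multiple `f g` and `g` have exponents in a subgroup, then so has `f`. -/
lemma support_subset_of_mul {Λ : AddSubgroup (V →₀ ℤ)} {f g : Laurent k V} (hg0 : g ≠ 0)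
    (hg : ∀ a ∈ g.coeff.support, a ∈ Λ) (hfg : ∀ a ∈ (f * g).coeff.support, a ∈ Λ) :
    ∀ a ∈ f.coeff.support, a ∈ Λ := by
  classical
  let f₁ : Laurent k V := .ofCoeff (f.coeff.filter fun a => a ∈ Λ)
  let f₂ : Laurent k V := .ofCoeff (f.coeff.filter fun a => ¬ a ∈ Λ)
  have hf : f₁ + f₂ = f := AddMonoidAlgebra.coeff_injective
    (Finsupp.filter_add_filter_not f.coeff _)
  have h1 : ∀ a ∈ f₁.coeff.support, a ∈ Λ := fun a ha => by
    simp only [f₁, Finsupp.support_filter, Finset.mem_filter] at ha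
    exact ha.2
  have h2 : ∀ a ∈ f₂.coeff.support, a ∉ Λ := fun a ha => by
    simp only [f₂, Finsupp.support_filter, Finset.mem_filter] at ha
    exact ha.2
  -- The exponents of this product lie outside Λ, while those of f g - f₁ g, which equals it, lie
  -- inside.
  have h3 : f₂ * g = 0 := by
    apply AddMonoidAlgebra.coeff_injective
    rw [AddMonoidAlgebra.coeff_zero, ← Finsupp.support_eq_empty, Finset.eq_empty_iff_forall_notMem]
    intro a ha
    obtain ⟨b, hb, c, hc, hbc⟩ := mem_support_mul ha
    have hnot : a ∉ Λ := by
      rw [← hbc, Λ.add_mem_cancel_right (hg c hc)]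
      exact h2 b hb
    have heq : f₂ * g = f * g + -(f₁ * g) := by rw [← hf]; ring
    rw [heq] at ha
    rcases Finset.mem_union.mp (Finsupp.support_add ha) with h | h
    · exact hnot (hfg a h)
    · have h' : a ∈ (f₁ * g).coeff.support := by
        rw [Finsupp.mem_support_iff] at h ⊢
        simpa using h
      obtain ⟨b, hb, c, hc, rfl⟩ := mem_support_mul h'
      exact hnot (add_mem (h1 b hb) (hg c hc))
  rcases mul_eq_zero.mp h3 with h | h
  · rw [h, add_zero] at hf
    rwa [← hf]
  · exact absurd h hg0

end Support

/-! ### Normality of Laurent polynomial rings -/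

section IntegrallyClosed

variable (k V : Type*) [Field k]

/-- The inclusion of polynomials into Laurent polynomials. -/
noncomputable def polyToLaurent : MvPolynomial V k →ₐ[k] Laurent k V :=
  AddMonoidAlgebra.mapDomainAlgHom k k (Finsupp.mapRange.addMonoidHom (Nat.castAddMonoidHom ℤ))

/-- The multiplicative set of monomials. -/
noncomputable def monomialSubmonoid : Submonoid (MvPolynomial V k) where
  carrier := Set.range fun a : V →₀ ℕ => MvPolynomial.monomial a (1 : k)
  one_mem' := ⟨0, rfl⟩
  mul_mem' := by
    rintro _ _ ⟨a, rfl⟩ ⟨b, rfl⟩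
    exact ⟨a + b, by simp [MvPolynomial.monomial_mul]⟩

variable {k V}

lemma polyToLaurent_monomial (a : V →₀ ℕ) (c : k) :
    polyToLaurent k V (MvPolynomial.monomial a c) =
      AddMonoidAlgebra.single (a.mapRange (Nat.cast : ℕ → ℤ) Nat.cast_zero) c := by
  change AddMonoidAlgebra.mapDomainAlgHom k k _ (AddMonoidAlgebra.single a c) = _
  simp

lemma polyToLaurent_injective : Function.Injective (polyToLaurent k V) := by
  have h : Function.Injective (Finsupp.mapRange.addMonoidHom (ι := V) (Nat.castAddMonoidHom ℤ)) :=
    Finsupp.mapRange_injective _ Nat.cast_zero Nat.cast_injective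
  exact AddMonoidAlgebra.mapDomain_injective h

lemma xpow_mul_xpow_neg (a : V →₀ ℤ) : xpow k a * xpow k (-a) = 1 := by
  rw [← xpow_add, add_neg_cancel, xpow_zero]

lemma exists_mul_polyToLaurent (f : Laurent k V) :
    ∃ m ∈ monomialSubmonoid k V, ∃ p, f * polyToLaurent k V m = polyToLaurent k V p := by
  induction f using AddMonoidAlgebra.induction_linear with
  | zero => exact ⟨1, one_mem _, 0, by simp⟩
  | add f g hf hg =>
    obtain ⟨m, hm, p, hp⟩ := hf
    obtain ⟨n, hn, q, hq⟩ := hg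
    refine ⟨m * n, mul_mem hm hn, p * n + q * m, ?_⟩
    simp only [map_mul, map_add, ← hp, ← hq]
    ring
  | single a c =>
    -- The negative part of the exponent clears denominators and leaves the positive part.
    refine ⟨_, ⟨a.mapRange (fun z => (-z).toNat) (by simp), rfl⟩,
      MvPolynomial.monomial (a.mapRange Int.toNat (by simp)) c, ?_⟩
    rw [polyToLaurent_monomial, polyToLaurent_monomial, AddMonoidAlgebra.single_mul_single, mul_one]
    congr 1
    ext v
    simp
    omega

/-- The ring is the localization of a polynomial ring at its monomials, and localization preserves
integral closedness. -/
instance : IsIntegrallyClosed (Laurent k V) := by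
  let _ : Algebra (MvPolynomial V k) (Laurent k V) := (polyToLaurent k V).toRingHom.toAlgebra
  have : IsLocalization (monomialSubmonoid k V) (Laurent k V) := by
    refine ⟨?_, ?_, ?_⟩
    · rintro ⟨_, a, rfl⟩
      refine IsUnit.of_mul_eq_one (xpow k (-(a.mapRange (Nat.cast : ℕ → ℤ) Nat.cast_zero))) ?_
      change polyToLaurent k V _ * _ = 1
      rw [polyToLaurent_monomial]
      exact xpow_mul_xpow_neg _
    · intro f
      obtain ⟨m, hm, p, hp⟩ := exists_mul_polyToLaurent f
      exact ⟨(p, ⟨m, hm⟩), hp⟩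
    · intro p q h
      exact ⟨1, by rw [polyToLaurent_injective h]⟩
  refine isIntegrallyClosed_of_isLocalization (R := MvPolynomial V k) _ (monomialSubmonoid k V) ?_
  rintro _ ⟨a, rfl⟩
  rw [mem_nonZeroDivisors_iff_ne_zero]
  simp

end IntegrallyClosed

/-! ### Normalizations of monomial algebras -/

section Normalization

variable {k V : Type*} [Field k]

/-- By Farkas' lemma a finitely generated cone is an intersection of half-spaces, so linear forms
detect membership. -/
lemma mem_coneLattice_of_forall_dual {R : Set (V →₀ ℤ)} (hR : R.Finite) {a : V →₀ ℤ}
    (ha : a ∈ AddSubgroup.closure R)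
    (h : ∀ φ : (V →₀ ℤ) →+ ℝ, (∀ b ∈ R, 0 ≤ φ b) → 0 ≤ φ a) : a ∈ coneLattice R := by
  refine ⟨ha, ?_⟩
  change toRealVec V a ∈ Submodule.span ℝ≥0 (toRealVec V '' R)
  by_contra hcone
  obtain ⟨φ, hφ, hneg⟩ := exists_dual_nonneg_and_neg hR.toFinset (toRealVec V) (toRealVec V a) (by
    intro c hc hsum
    apply hcone
    rw [← hsum]
    refine Submodule.sum_mem _ fun b hb => ?_
    exact Submodule.smul_mem _ (⟨c b, hc b hb⟩ : ℝ≥0)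
      (Submodule.subset_span ⟨b, hR.mem_toFinset.mp hb, rfl⟩))
  exact absurd (h (φ.toAddMonoidHom.comp (toRealVec V)) fun b hb => hφ b (hR.mem_toFinset.mpr hb))
    (not_le.mpr hneg)

lemma exists_sub_of_mem_closure {M : Type*} [AddCommGroup M] {R : Set M} {a : M}
    (ha : a ∈ AddSubgroup.closure R) :
    ∃ b ∈ AddSubmonoid.closure R, ∃ c ∈ AddSubmonoid.closure R, a + c = b := by
  induction ha using AddSubgroup.closure_induction with
  | mem x hx => exact ⟨x, AddSubmonoid.subset_closure hx, 0, zero_mem _, add_zero x⟩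
  | zero => exact ⟨0, zero_mem _, 0, zero_mem _, add_zero 0⟩
  | add x y _ _ hx hy =>
    obtain ⟨b, hb, c, hc, h⟩ := hx
    obtain ⟨b', hb', c', hc', h'⟩ := hy
    exact ⟨b + b', add_mem hb hb', c + c', add_mem hc hc', by rw [← h, ← h']; abel⟩
  | neg x _ hx =>
    obtain ⟨b, hb, c, hc, h⟩ := hx
    exact ⟨c, hc, b, hb, by rw [← h]; abel⟩

lemma fracIncl_algebraMap {L : Type*} [CommRing L] [IsDomain L] [Algebra k L] (A : Subalgebra k L)
    (a : A) : fracIncl A (algebraMap A (FractionRing A) a) = algebraMap L (FractionRing L) a := by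
  exact IsFractionRing.lift_algebraMap
    (g := ((IsScalarTower.toAlgHom k L (FractionRing L)).comp A.val).toRingHom)
    ((IsFractionRing.injective L (FractionRing L)).comp Subtype.val_injective) a

lemma mem_normalizationIn {L : Type*} [CommRing L] [IsDomain L] [Algebra k L] {A : Subalgebra k L}
    {x : FractionRing L} :
    x ∈ normalizationIn A ↔ ∃ y : FractionRing A, IsIntegral A y ∧ fracIncl A y = x := Iff.rfl

/-- The normalization of the algebra of a finite set of monomials is the algebra of the
semigroup `ℝ₊R ∩ ℤR`, provided that every element of this semigroup has a multiple in the
semigroup generated by `R`. -/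
theorem normalizationIn_monomialAlgebra {R : Set (V →₀ ℤ)} (hR : R.Finite) {N : ℕ} (hN : 0 < N)
    (hmul : ∀ a ∈ coneLattice R, N • a ∈ AddSubmonoid.closure R) :
    normalizationIn (monomialAlgebra k R) =
      (monomialAlgebra k (coneLattice R : Set (V →₀ ℤ))).map
        (IsScalarTower.toAlgHom k (Laurent k V) (FractionRing (Laurent k V))) := by
  set A := monomialAlgebra k R with hA
  have hcomp : ∀ a : A, fracIncl A (algebraMap A (FractionRing A) a) =
      algebraMap (Laurent k V) (FractionRing (Laurent k V)) a := fracIncl_algebraMap A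
  apply le_antisymm
  · rintro _ hx
    obtain ⟨y, hy, rfl⟩ := mem_normalizationIn.mp hx
    have hintA : IsIntegral A (fracIncl A y) :=
      hy.map_of_comp_eq (RingHom.id A) (fracIncl A).toRingHom (by
        ext a
        exact (hcomp a).symm)
    -- Normality of the Laurent ring turns the integral fraction into a Laurent polynomial f, whose
    -- exponents can then be examined.
    obtain ⟨f, hf⟩ := IsIntegrallyClosed.isIntegral_iff.mp (hintA.tower_top (A := Laurent k V))
    have hintf : IsIntegral A f := by
      rw [← hf] at hintA
      exact (isIntegral_algebraMap_iff (IsFractionRing.injective _ _)).mp hintA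
    refine ⟨f, ?_, hf⟩
    refine mem_monomialAlgebra_of_support fun a ha => AddSubmonoid.subset_closure ?_
    refine mem_coneLattice_of_forall_dual hR ?_ fun φ hφ => ?_
    · obtain ⟨g, h, hh, rfl⟩ := IsFractionRing.div_surjective (A := A) y
      have hh0 : (h : Laurent k V) ≠ 0 := fun h0 =>
        nonZeroDivisors.ne_zero hh (Subtype.ext h0)
      have hle : ∀ b ∈ A, ∀ a ∈ b.coeff.support, a ∈ AddSubgroup.closure R := fun b hb a ha =>
        AddSubmonoid.closure_le (S := (AddSubgroup.closure R).toAddSubmonoid).mpr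
          AddSubgroup.subset_closure (support_subset_of_mem_monomialAlgebra hb a ha)
      have hfg : f * h = g := by
        apply IsFractionRing.injective (Laurent k V) (FractionRing (Laurent k V))
        rw [map_mul, hf, map_div₀, hcomp, hcomp, div_mul_cancel₀]
        exact fun h0 => hh0 (IsFractionRing.injective _ (FractionRing (Laurent k V))
          (h0.trans (map_zero _).symm))
      exact support_subset_of_mul hh0 (hle _ h.2) (by rw [hfg]; exact hle _ g.2) a ha
    · refine supportGE_of_isIntegral (fun b hb c hc => ?_) hintf a ha
      replace hc := support_subset_of_mem_monomialAlgebra hb c hc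
      induction hc using AddSubmonoid.closure_induction with
      | mem x hx => exact hφ x hx
      | zero => simp
      | add x y _ _ hx hy => rw [map_add]; exact add_nonneg hx hy
  · rw [monomialAlgebra, AlgHom.map_adjoin]
    refine Algebra.adjoin_le ?_
    rintro _ ⟨_, ⟨a, ha, rfl⟩, rfl⟩
    -- Since a = b - c, the monomial x^a is the fraction x^b / x^c over A, and its N-th power lies
    -- in A.
    obtain ⟨b, hb, c, hc, hbc⟩ := exists_sub_of_mem_closure ha.1
    let xb : A := ⟨xpow k b, xpow_mem_monomialAlgebra hb⟩
    let xc : A := ⟨xpow k c, xpow_mem_monomialAlgebra hc⟩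
    let xa : A := ⟨xpow k (N • a), xpow_mem_monomialAlgebra (hmul a ha)⟩
    let y : FractionRing A := algebraMap A _ xb / algebraMap A _ xc
    have hy : fracIncl A y = algebraMap (Laurent k V) (FractionRing (Laurent k V)) (xpow k a) := by
      rw [map_div₀, hcomp, hcomp, div_eq_iff, ← map_mul, ← xpow_add, hbc]
      intro h0
      have h1 : xpow k c = 0 := IsFractionRing.injective _ (FractionRing (Laurent k V))
        (h0.trans (map_zero _).symm)
      have := xpow_mul_xpow_neg (k := k) c
      rw [h1, zero_mul] at this
      exact zero_ne_one this
    have hpow : ∀ n : ℕ, xpow k (n • a) = xpow k a ^ n := by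
      intro n
      induction n with
      | zero => simp [xpow_zero]
      | succ n ih => rw [succ_nsmul, xpow_add, ih, pow_succ]
    refine mem_normalizationIn.mpr ⟨y, ?_, hy⟩
    have hyN : y ^ N = algebraMap A _ xa := by
      apply (fracIncl A).toRingHom.injective
      change fracIncl A (y ^ N) = fracIncl A _
      rw [map_pow, hy, hcomp, ← map_pow, ← hpow]
    exact IsIntegral.of_pow hN (hyN ▸ isIntegral_algebraMap)

end Normalization

/-! ### The theorem for mixed graphs -/

lemma MixedGraph.rhoSet_finite {V : Type*} [Finite V] (G : MixedGraph V) : G.rhoSet.Finite :=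
  ((Set.toFinite G.edges).image _).union ((Set.toFinite G.arcs).image _)

/-- `A(P_G)` is the normalization of `k[G]`; it is generated over `k[G]` by the monomials of the
exceptional pairs of the augmented graph, for either reading of "path"; and any family of
exceptional pairs that generates the normalization of the edge ring of the augmented graph also
generates that of `k[G]`. Everything is viewed in the Laurent polynomial ring on the vertices of
the augmented graph. -/
theorem theoremB {k V : Type*} [Field k] [Finite V] (G : MixedGraph V) :
    normalizationIn (G.edgeRing k) =
      (G.ehrhartRing k).map (IsScalarTower.toAlgHom k (Laurent k V) (FractionRing (Laurent k V))) ∧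
    (G.ehrhartRing k).map (laurentInl k V G.arcs) =
      generatedOver ((G.edgeRing k).map (laurentInl k V G.arcs))
        (SignedGraph.pairMonomial k '' G.augmented.exceptionalPairs) ∧
    (G.ehrhartRing k).map (laurentInl k V G.arcs) =
      generatedOver ((G.edgeRing k).map (laurentInl k V G.arcs))
        (SignedGraph.pairMonomial k '' G.augmented.walkExceptionalPairs) ∧
    ∀ S ⊆ G.augmented.exceptionalPairs,
      G.augmented.ehrhartRing k =
        generatedOver (G.augmented.edgeRing k) (SignedGraph.pairMonomial k '' S) →
      (G.ehrhartRing k).map (laurentInl k V G.arcs) =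
        generatedOver ((G.edgeRing k).map (laurentInl k V G.arcs))
          (SignedGraph.pairMonomial k '' S) :=
  ⟨normalizationIn_monomialAlgebra G.rhoSet_finite two_pos fun _ => G.two_smul_mem_closure,
    G.ehrhartRing_map_eq_of_augmented _ (G.augmented.ehrhartRing_eq_generatedOver
      SignedGraph.walkExceptionalPairs_subset subset_rfl),
    G.ehrhartRing_map_eq_of_augmented _ (G.augmented.ehrhartRing_eq_generatedOver
      subset_rfl SignedGraph.walkExceptionalPairs_subset),
    fun S _ => G.ehrhartRing_map_eq_of_augmented S⟩
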